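/- **Proof systems.** Let $\mathsf{NIZK}=(\mathsf{Setup},\mathsf{Prove},\mathsf{Verify},\mathsf{Rand})$ be a non-interactive proof system (for example Groth's) for a polynomial-time decidable relation $R$, possibly depending on the parameters, with probabilistic polynomial-time (PPT) algorithms $\mathsf{Setup}(1^\lambda)\to pp$, $\mathsf{Prove}(pp,x,w)\to\pi$, $\mathsf{Verify}(pp,x,\pi)\in\{0,1\}$ and a proof randomization algorithm $\mathsf{Rand}(pp,x,\pi)\to\pi'$. Assume that it is perfectly complete: for $pp$ generated by $\mathsf{Setup}$ and $(x,w)\in R$, every proof generated by $\mathsf{Prove}(pp,x,w)$ is accepted with probability $1$. Its proofs are *randomizable* if every PPT adversary $\mathcal A$ has negligible distinguishing advantage $|\Pr[\mathcal A\to1\mid b=1]-\Pr[\mathcal A\to1\mid b=0]|$ in the following game: $\mathcal A$ receives $1^\lambda$ and $pp\leftarrow\mathsf{Setup}(1^\lambda)$; once, it submits $(x,w,\pi)$ with $(x,w)\in R$ and $\mathsf{Verify}(pp,x,\pi)=1$, and receives $\mathsf{Rand}(pp,x,\pi)$ if $b=1$ and a fresh proof $\mathsf{Prove}(pp,x,w)$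 if $b=0$ (an invalid submission yields the empty answer); finally it outputs a bit. **User privacy experiment.** Let $\mathcal B$ be an adversary and $\mathcal D$ a simulator that plays the challenger. (1) $pp\leftarrow\mathsf{Setup}(1^\lambda)$; on $(1^\lambda,pp)$, $\mathcal D$ runs key generation and outputs public keys $pk$; $\mathcal B$ receives $(1^\lambda,pp,pk)$. (2) As often as its running time permits and in any order, $\mathcal B$ submits documents $doc'$ to "request", receiving a response $R'$ from $\mathcal D$ (as KYC provider), and queries $Q'$ to "issue", receiving the answer of $\mathcal D$ (as issuer); it runs "update" internally. (3) $\mathcal B$ submits an identity $\mathrm{zkFaith}'$ to "show", and $\mathcal D$ (as verifier) outputs $0$ or $1$, which is the output of the experiment. In all phases $\mathcal D$ keeps a state and may call a prover that on $(x,w)\in R$ returns $\mathsf{Prove}(pp,x,w)$ (and the empty string on other pairs). $U_{\mathrm{Pri}}^{\mathcal B,\mathcal D}(\lambda)$ denotes this experiment. The modified simulator $\mathcal D'$ runs identically to $\mathcal D$, except that each proof $\pi$ obtained from the prover for a statement $x$ is replaced by its randomization $\mathsf{Rand}(pp,x,\pi)$. **Theorem.** Suppose that the proofs of $\mathsf{NIZK}$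 are randomizable. Then for every PPT adversary $\mathcal B$ and every simulator $\mathcal D$ such that each of its activations takes time polynomial in $\lambda$ and $|pp|$ (whatever its state and the incoming message), there is a negligible function $\mathrm{negl}$ such that for all $\lambda$ $$\bigl|\Pr[U_{\mathrm{Pri}}^{\mathcal B,\mathcal D}(\lambda)=1]-\Pr[U_{\mathrm{Pri}}^{\mathcal B,\mathcal D'}(\lambda)=1]\bigr|<\mathrm{negl}(\lambda).$$ -/

import Mathlib

open Filter

noncomputable section

namespace ZkFaith

/-! ### Probabilistic programs on bit strings, with a step count -/

/-- Bit strings. -/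
abbrev Word := List Bool

/-- The memory of a program: registers, each holding a bit string (a stack of bits). -/
abbrev Regs := ℕ → Word

/-- Total length of a list of bit strings. -/
def totalLength (l : List Word) : ℕ := (l.map List.length).sum

/-- The initial memory: the inputs in registers `0, 1, 2, …`, all other registers empty. -/
def Regs.ofInputs (inputs : List Word) : Regs := fun i => inputs.getD i []

/-- `1ⁿ`, the security parameter in unary. -/
def unary (n : ℕ) : Word := List.replicate n true

/-- Probabilistic oracle programs. A program mentions only finitely many registers. The only loop
is the bounded loop, so that every program halts; a machine with a polynomial clock is a nest of
such loops around its transition function, two registers representing one tape. -/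
inductive Prog : Type
  /-- Do nothing. -/
  | skip : Prog
  /-- Put the bit `b` in front of register `r`. -/
  | push (r : ℕ) (b : Bool) : Prog
  /-- Remove the first bit of register `r`, if there is one. -/
  | pop (r : ℕ) : Prog
  /-- Put a fair random bit in front of register `r`. -/
  | coin (r : ℕ) : Prog
  /-- Move the content of `src` to `dst`, leaving `src` empty. -/
  | move (dst src : ℕ) : Prog
  /-- Copy the content of `src` to `dst`. -/
  | copy (dst src : ℕ) : Prog
  /-- Send the contents of the registers `args` to the oracle, store the answer in `res`. -/
  | call (args : List ℕ) (res : ℕ) : Prog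
  /-- Sequential composition. -/
  | seq (p q : Prog) : Prog
  /-- Run `p` if the first bit of register `r` is `b` (`none`: the register is empty), else `q`. -/
  | ifTop (r : ℕ) (b : Option Bool) (p q : Prog) : Prog
  /-- Run `p` as many times as register `r` has bits on entry. -/
  | loop (r : ℕ) (p : Prog) : Prog

/-- A stateful randomized oracle: query and state to answer and new state. -/
abbrev Oracle (σ : Type) := List Word → σ → PMF (Word × σ)

/-- A configuration: registers, state of the oracle, number of steps taken so far. -/
structure Cfg (σ : Type) where
  regs : Regs
  env : σ
  time : ℕ

namespace Cfg

variable {σ : Type}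

/-- Charge `k` steps. -/
def tick (c : Cfg σ) (k : ℕ) : Cfg σ := { c with time := c.time + k }

/-- Overwrite register `r`. -/
def set (c : Cfg σ) (r : ℕ) (w : Word) : Cfg σ := { c with regs := Function.update c.regs r w }

/-- The start of a run. -/
def start (inputs : List Word) (s : σ) : Cfg σ := ⟨Regs.ofInputs inputs, s, 0⟩

end Cfg

/-- Repeat a randomized transformation `n` times. -/
def repeatM {α : Type} (f : α → PMF α) : ℕ → α → PMF α
  | 0, a => PMF.pure a
  | n + 1, a => (f a).bind (repeatM f n)

/-- The distribution of the final configuration of a program that runs with oracle `O`. One step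
is charged for each instruction and each round of a loop; copying a string and sending it to the
oracle cost its length in addition. -/
def Prog.run {σ : Type} (O : Oracle σ) : Prog → Cfg σ → PMF (Cfg σ)
  | .skip, c => PMF.pure (c.tick 1)
  | .push r b, c => PMF.pure ((c.set r (b :: c.regs r)).tick 1)
  | .pop r, c => PMF.pure ((c.set r (c.regs r).tail).tick 1)
  | .coin r, c =>
      (PMF.uniformOfFintype Bool).bind fun b => PMF.pure ((c.set r (b :: c.regs r)).tick 1)
  | .move dst src, c => PMF.pure (((c.set src []).set dst (c.regs src)).tick 1)
  | .copy dst src, c => PMF.pure ((c.set dst (c.regs src)).tick (1 + (c.regs src).length))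
  | .call args res, c =>
      (O (args.map c.regs) c.env).bind fun a =>
        PMF.pure ((({ c with env := a.2 } : Cfg σ).set res a.1).tick
          (1 + totalLength (args.map c.regs)))
  | .seq p q, c => (p.run O c).bind (q.run O)
  | .ifTop r b p q, c =>
      if (c.regs r).head? = b then p.run O (c.tick 1) else q.run O (c.tick 1)
  | .loop r p, c =>
      repeatM (p.run O) (c.regs r).length (c.tick (1 + (c.regs r).length))

/-- The oracle that is not there. -/
def noOracle : Oracle Unit := fun _ s => PMF.pure ([], s)

/-- The output distribution of a randomized algorithm without oracle: register `0` at the end. -/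
def Prog.out (p : Prog) (inputs : List Word) : PMF Word :=
  (p.run noOracle (Cfg.start inputs ())).map fun c => c.regs 0

/-- Whatever the oracle does, on these inputs `p` always halts within `t` steps. -/
def Prog.TimeBound (p : Prog) (inputs : List Word) (t : ℕ) : Prop :=
  ∀ (σ : Type) (O : Oracle σ) (s : σ), ∀ c ∈ (p.run O (Cfg.start inputs s)).support, c.time ≤ t

/-- Probabilistic polynomial time: strictly polynomial in the total length of the inputs. -/
def Prog.PPT (p : Prog) : Prop :=
  ∃ f : Polynomial ℕ, ∀ inputs : List Word, p.TimeBound inputs (f.eval (totalLength inputs))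

/-- Negligible functions of the security parameter. -/
def Negligible (ν : ℕ → ℝ) : Prop :=
  Asymptotics.SuperpolynomialDecay atTop (fun n : ℕ => (n : ℝ)) ν

/-- The probability that an experiment outputs `1`. -/
def prOne (e : PMF Bool) : ℝ := (e true).toReal

/-! ### Non-interactive proof systems and randomizability -/

/-- A non-interactive proof system for a polynomial-time decidable relation, together with an
algorithm that randomizes proofs. -/
structure NIZK where
  /-- `Setup(1ⁿ) → pp`. -/
  setup : Prog
  /-- `Prove(pp, x, w) → π`. -/
  prove : Prog
  /-- `Verify(pp, x, π)`, which accepts by returning the string `1`. -/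
  verify : Prog
  /-- `Rand(pp, x, π) → π'`. -/
  rand : Prog
  /-- The relation between statements `x` and witnesses `w`, for parameters `pp`. -/
  rel : Word → Word → Word → Bool
  /-- A program that decides the relation. -/
  decideRel : Prog
  decideRel_out : ∀ pp x w, decideRel.out [pp, x, w] = PMF.pure [rel pp x w]
  setup_ppt : setup.PPT
  prove_ppt : prove.PPT
  verify_ppt : verify.PPT
  rand_ppt : rand.PPT
  decideRel_ppt : decideRel.PPT

namespace NIZK

/-- Perfect completeness: honestly generated proofs of true statements are accepted. -/
def Complete (N : NIZK) : Prop :=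
  ∀ n : ℕ, ∀ pp ∈ (N.setup.out [unary n]).support, ∀ x w, N.rel pp x w = true →
    ∀ π ∈ (N.prove.out [pp, x, w]).support, N.verify.out [pp, x, π] = PMF.pure [true]

/-- The challenge of the randomizability game. It is given once (the state records whether it is
used up): on a statement `x`, a witness `w` for it and an accepted proof `π` of it, all chosen by
the adversary, return a randomization of `π` if `b`, and a fresh proof otherwise. -/
def challenge (N : NIZK) (b : Bool) (pp : Word) : Oracle Bool := fun args used =>
  let x := args.getD 0 []
  let w := args.getD 1 []
  let π := args.getD 2 []
  if used = false ∧ N.rel pp x w = true then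
    (N.verify.out [pp, x, π]).bind fun v =>
      if v = [true] then
        (if b then N.rand.out [pp, x, π] else N.prove.out [pp, x, w]).map fun π' => (π', true)
      else PMF.pure ([], true)
  else PMF.pure ([], true)

/-- The randomizability game: the adversary gets `1ⁿ` and the parameters, asks for its challenge,
and outputs a guess. -/
def randGame (N : NIZK) (A : Prog) (b : Bool) (n : ℕ) : PMF Bool :=
  (N.setup.out [unary n]).bind fun pp =>
    (A.run (N.challenge b pp) (Cfg.start [unary n, pp] false)).map fun c =>
      decide (c.regs 0 = [true])

/-- Proofs are randomizable: no PPT adversary can tell a randomized proof from a fresh one. -/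
def Randomizable (N : NIZK) : Prop :=
  ∀ A : Prog, A.PPT →
    Negligible fun n => |prOne (N.randGame A true n) - prOne (N.randGame A false n)|

/-- The prover that answers a pair `(x, w)` of the relation with a fresh proof of `x`. -/
def freshProofs (N : NIZK) (pp : Word) : Oracle Unit := fun args s =>
  let x := args.getD 0 []
  let w := args.getD 1 []
  if N.rel pp x w = true then (N.prove.out [pp, x, w]).map fun π => (π, s)
  else PMF.pure ([], s)

/-- The same prover, which randomizes each proof before it hands it over. -/
def randomizedProofs (N : NIZK) (pp : Word) : Oracle Unit := fun args s =>
  let x := args.getD 0 []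
  let w := args.getD 1 []
  if N.rel pp x w = true then
    (N.prove.out [pp, x, w]).bind fun π => (N.rand.out [pp, x, π]).map fun π' => (π', s)
  else PMF.pure ([], s)

end NIZK

/-! ### The user privacy experiment -/

/-- A simulator of the challenger: its code for the phases of the protocol. In every activation it
obtains the NIZK proofs that it needs by calls of a prover on a statement and a witness. -/
structure Simulator where
  /-- Set-up and key generation: on `(1ⁿ, pp)`, returns the public keys. -/
  keyGen : Prog
  /-- The KYC provider: on `(1ⁿ, pp, st, doc')`, returns the response `R'`. -/
  request : Prog
  /-- The issuer: on `(1ⁿ, pp, st, Q')`, returns the issued signature and proofs. -/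
  issue : Prog
  /-- The verifier: on `(1ⁿ, pp, st, zkFaith')`, returns the string `1` for acceptance. -/
  showPhase : Prog

/-- One activation: the answer is left in register `0`, the state of the simulator that is kept
for its next activation in register `1`. -/
def activate (P : Oracle Unit) (code : Prog) (inputs : List Word) : PMF (Word × Word) :=
  (code.run P (Cfg.start inputs ())).map fun c => (c.regs 0, c.regs 1)

namespace Simulator

/-- An interactive PPT machine: every activation takes a number of steps that is polynomial in
the security parameter and the size of the parameters, whatever messages arrive. -/
def PPT (D : Simulator) : Prop :=
  ∃ f : Polynomial ℕ, ∀ (n : ℕ) (pp : Word),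
    D.keyGen.TimeBound [unary n, pp] (f.eval (n + pp.length)) ∧
    ∀ st msg : Word,
      D.request.TimeBound [unary n, pp, st, msg] (f.eval (n + pp.length)) ∧
      D.issue.TimeBound [unary n, pp, st, msg] (f.eval (n + pp.length)) ∧
      D.showPhase.TimeBound [unary n, pp, st, msg] (f.eval (n + pp.length))

/-- The oracle that the adversary faces, with the state of the simulator as its state. A query
consists of a selector and a message; the selector `1` stands for "issue", any other one for
"request". -/
def oracle (D : Simulator) (P : Oracle Unit) (n : ℕ) (pp : Word) : Oracle Word := fun args st =>
  activate P (if args.getD 0 [] = [true] then D.issue else D.request)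
    [unary n, pp, st, args.getD 1 []]

end Simulator

/-- The user privacy experiment between the adversary `B` and the simulator `D`, where `prover`
(given the parameters) generates the NIZK proofs of `D`. The parameters are generated, `D`
generates the keys, `B` gets the parameters and the public keys, makes "request" and "issue"
queries in any order, and finally submits `zkFaith'`; the output is the verdict of "show". -/
def privacyExperiment (N : NIZK) (prover : Word → Oracle Unit) (D : Simulator) (B : Prog)
    (n : ℕ) : PMF Bool :=
  (N.setup.out [unary n]).bind fun pp =>
    (activate (prover pp) D.keyGen [unary n, pp]).bind fun k =>
      (B.run (D.oracle (prover pp) n pp) (Cfg.start [unary n, pp, k.1] k.2)).bind fun c =>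
        (activate (prover pp) D.showPhase [unary n, pp, c.env, c.regs 0]).map fun v =>
          decide (v.1 = [true])

/-- The experiment run with the simulator `D`. -/
def UPri (N : NIZK) (B : Prog) (D : Simulator) : ℕ → PMF Bool :=
  privacyExperiment N N.freshProofs D B

/-- The experiment run with the modified simulator `D'`: it runs identically to `D`, except that
every NIZK proof is randomized. -/
def UPriModified (N : NIZK) (B : Prog) (D : Simulator) : ℕ → PMF Bool :=
  privacyExperiment N N.randomizedProofs D B

end ZkFaith

end

/-!
This is a hybrid argument. The `j`-th hybrid experiment is the privacy experiment in which the first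
`j` proofs are randomized and the others are left alone. The adversary makes polynomially many
queries and each activation of the simulator makes polynomially many calls to the prover, so for
some `a` and `b` the hybrid with `j = 0` is the experiment with `D`, and the one with
`j = (n + 2) ^ b` is already the experiment with `D'`.

The distinguisher chooses a uniformly random `i < 2 ^ k`, where `(n + 2) ^ b < 2 ^ k`, and runs the
privacy experiment by itself, randomizing the first `i` proofs and submitting the next one as its
challenge. By perfect completeness the challenge is valid, so its answer is a randomized proof if
`b = 1`, which gives hybrid `i + 1`, and a fresh proof, distributed like the one it replaces, if
`b = 0`, which gives hybrid `i`. The advantage telescopes to the distance between the extreme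
hybrids divided by `2 ^ k ≤ 2 * (n + 2) ^ b`.

The distinguisher has to be a program that respects its time bound for every oracle. It therefore
cuts the public keys off at length `(n + 2) ^ a`, which changes nothing within the experiment. That
the program does what is said above is shown by coupling its runs with the mathematical experiment.
-/

noncomputable section

namespace ZkFaith

section Coupling

universe u v

theorem bind_congr_support {α : Type u} {β : Type v} {p : PMF α} {f g : α → PMF β}
    (h : ∀ a ∈ p.support, f a = g a) : p.bind f = p.bind g := by
  ext b
  simp only [PMF.bind_apply]
  refine tsum_congr fun a => ?_
  by_cases ha : p a = 0
  · simp only [ha, zero_mul]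
  · rw [h a ((PMF.mem_support_iff _ _).2 ha)]

/-- There is a coupling of `μ` and `ν` that is supported on the relation `R`. -/
def Coupled {α : Type u} {β : Type v} (R : α → β → Prop) (μ : PMF α) (ν : PMF β) : Prop :=
  ∃ κ : PMF (α × β), κ.map Prod.fst = μ ∧ κ.map Prod.snd = ν ∧ ∀ x ∈ κ.support, R x.1 x.2

namespace Coupled

variable {α β γ δ : Type*} {R : α → β → Prop} {μ : PMF α} {ν : PMF β}

theorem pure {a : α} {b : β} (h : R a b) : Coupled R (PMF.pure a) (PMF.pure b) := by
  refine ⟨PMF.pure (a, b), PMF.pure_map _ _, PMF.pure_map _ _, fun x hx => ?_⟩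
  obtain rfl : x = (a, b) := by simpa only [PMF.support_pure, Set.mem_singleton_iff] using hx
  exact h

theorem refl (μ : PMF α) : Coupled (fun a b => a = b) μ μ := by
  refine ⟨μ.map fun a => (a, a), ?_, ?_, fun x hx => ?_⟩
  · rw [PMF.map_comp]; exact PMF.map_id μ
  · rw [PMF.map_comp]; exact PMF.map_id μ
  · obtain ⟨a, -, rfl⟩ := (PMF.mem_support_map_iff _ _ _).1 hx
    rfl

theorem product (μ : PMF α) (ν : PMF β) :
    Coupled (fun a b => a ∈ μ.support ∧ b ∈ ν.support) μ ν := by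
  refine ⟨μ.bind fun a => ν.map fun b => (a, b), ?_, ?_, fun x hx => ?_⟩
  · have hfst (a : α) : (ν.map fun b => (a, b)).map Prod.fst = PMF.pure a := by
      rw [PMF.map_comp]; exact PMF.map_const ν a
    simp only [PMF.map_bind, hfst, PMF.bind_pure]
  · have hsnd (a : α) : (ν.map fun b => (a, b)).map Prod.snd = ν := by
      rw [PMF.map_comp]; exact PMF.map_id ν
    simp only [PMF.map_bind, hsnd, PMF.bind_const]
  · obtain ⟨a, ha, hx⟩ := (PMF.mem_support_bind_iff _ _ _).1 hx
    obtain ⟨b, hb, rfl⟩ := (PMF.mem_support_map_iff _ _ _).1 hx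
    exact ⟨ha, hb⟩

theorem mono_support {S : α → β → Prop} (h : Coupled R μ ν)
    (hS : ∀ a ∈ μ.support, ∀ b ∈ ν.support, R a b → S a b) : Coupled S μ ν := by
  obtain ⟨κ, rfl, rfl, hκ⟩ := h
  exact ⟨κ, rfl, rfl, fun x hx => hS _ ((PMF.mem_support_map_iff _ _ _).2 ⟨x, hx, rfl⟩) _
    ((PMF.mem_support_map_iff _ _ _).2 ⟨x, hx, rfl⟩) (hκ x hx)⟩

theorem mono {S : α → β → Prop} (h : Coupled R μ ν) (hS : ∀ a b, R a b → S a b) :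
    Coupled S μ ν :=
  h.mono_support fun a _ b _ => hS a b

theorem bind {S : γ → δ → Prop} {f : α → PMF γ} {g : β → PMF δ} (h : Coupled R μ ν)
    (hfg : ∀ a b, R a b → Coupled S (f a) (g b)) : Coupled S (μ.bind f) (ν.bind g) := by
  obtain ⟨κ, rfl, rfl, hκ⟩ := h
  have (x : α × β) : ∃ k : PMF (γ × δ), k.map Prod.fst = f x.1 ∧ k.map Prod.snd = g x.2 ∧
      (R x.1 x.2 → ∀ y ∈ k.support, S y.1 y.2) := by
    by_cases hx : R x.1 x.2
    · obtain ⟨k, hf, hg, hS⟩ := hfg _ _ hx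
      exact ⟨k, hf, hg, fun _ => hS⟩
    · obtain ⟨k, hf, hg, -⟩ := product (f x.1) (g x.2)
      exact ⟨k, hf, hg, fun hx' => absurd hx' hx⟩
  choose k hf hg hS using this
  refine ⟨κ.bind k, ?_, ?_, fun y hy => ?_⟩
  · simp only [PMF.map_bind, PMF.bind_map, hf]; rfl
  · simp only [PMF.map_bind, PMF.bind_map, hg]; rfl
  · obtain ⟨x, hx, hy⟩ := (PMF.mem_support_bind_iff _ _ _).1 hy
    exact hS x (hκ x hx) y hy

theorem bind_left {S : γ → β → Prop} {f : α → PMF γ} (h : Coupled R μ ν)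
    (hf : ∀ a b, R a b → Coupled S (f a) (PMF.pure b)) : Coupled S (μ.bind f) ν := by
  simpa only [PMF.bind_pure] using h.bind (g := PMF.pure) hf

theorem pure_bind {S : γ → δ → Prop} {b : β} {f : α → PMF γ} {ν : PMF δ}
    (h : Coupled R μ (PMF.pure b)) (hf : ∀ a, R a b → Coupled S (f a) ν) :
    Coupled S (μ.bind f) ν := by
  simpa only [PMF.pure_bind] using
    (h.mono_support (S := fun a _ => R a b) fun a _ b' hb' hab =>
      (PMF.mem_support_pure_iff _ _).1 hb' ▸ hab).bind (g := fun _ => ν) fun a _ => hf a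

theorem map {S : γ → δ → Prop} {f : α → γ} {g : β → δ} (h : Coupled R μ ν)
    (hfg : ∀ a b, R a b → S (f a) (g b)) : Coupled S (μ.map f) (ν.map g) :=
  h.bind fun a b hab => pure (hfg a b hab)

theorem map_right {S : α → δ → Prop} {g : β → δ} (h : Coupled R μ ν)
    (hg : ∀ a b, R a b → S a (g b)) : Coupled S μ (ν.map g) := by
  simpa only [PMF.map_id] using h.map (f := id) (g := g) hg

theorem exists_of_mem_support (h : Coupled R μ ν) {a : α} (ha : a ∈ μ.support) :
    ∃ b ∈ ν.support, R a b := by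
  obtain ⟨κ, rfl, rfl, hκ⟩ := h
  obtain ⟨x, hx, rfl⟩ := (PMF.mem_support_map_iff _ _ _).1 ha
  exact ⟨x.2, (PMF.mem_support_map_iff _ _ _).2 ⟨x, hx, rfl⟩, hκ x hx⟩

theorem bind_eq {f : α → PMF γ} {g : β → PMF γ} (h : Coupled R μ ν)
    (hfg : ∀ a b, R a b → f a = g b) : μ.bind f = ν.bind g := by
  obtain ⟨κ, rfl, rfl, hκ⟩ := h
  simp only [PMF.bind_map]
  exact bind_congr_support fun x hx => hfg _ _ (hκ x hx)

theorem map_eq {f : α → γ} {g : β → γ} (h : Coupled R μ ν) (hfg : ∀ a b, R a b → f a = g b) :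
    μ.map f = ν.map g :=
  h.bind_eq fun a b hab => congrArg PMF.pure (hfg a b hab)

end Coupled

end Coupling

section Run

variable {σ τ : Type}

@[simp] theorem Cfg.tick_regs (c : Cfg σ) (k : ℕ) : (c.tick k).regs = c.regs := rfl

@[simp] theorem Cfg.tick_env (c : Cfg σ) (k : ℕ) : (c.tick k).env = c.env := rfl

@[simp] theorem Cfg.tick_time (c : Cfg σ) (k : ℕ) : (c.tick k).time = c.time + k := rfl

@[simp] theorem Cfg.set_regs (c : Cfg σ) (r : ℕ) (w : Word) :
    (c.set r w).regs = Function.update c.regs r w := rfl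

@[simp] theorem Cfg.set_env (c : Cfg σ) (r : ℕ) (w : Word) : (c.set r w).env = c.env := rfl

@[simp] theorem Cfg.set_time (c : Cfg σ) (r : ℕ) (w : Word) : (c.set r w).time = c.time := rfl

theorem repeatM_succ_right {α : Type} (f : α → PMF α) (n : ℕ) (a : α) :
    repeatM f (n + 1) a = (repeatM f n a).bind f := by
  induction n generalizing a with
  | zero => simp only [repeatM, PMF.pure_bind, PMF.bind_pure]
  | succ n ih =>
    rw [repeatM, repeatM, PMF.bind_bind]
    exact congrArg _ (funext ih)

theorem repeatM_invariant {α : Type} {f : α → PMF α} {P : α → Prop}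
    (h : ∀ a, P a → ∀ b ∈ (f a).support, P b) (n : ℕ) {a b : α} (ha : P a)
    (hb : b ∈ (repeatM f n a).support) : P b := by
  induction n generalizing a with
  | zero =>
    obtain rfl : b = a := (PMF.mem_support_pure_iff _ _).1 hb
    exact ha
  | succ n ih =>
    obtain ⟨a', ha', hb⟩ := (PMF.mem_support_bind_iff _ _ _).1 hb
    exact ih (h a ha a' ha') hb

theorem Coupled.repeatM {α β : Type} {f : α → PMF α} {g : β → PMF β} {R : α → β → Prop}
    (h : ∀ a b, R a b → Coupled R (f a) (g b)) (n : ℕ) {a : α} {b : β} (hab : R a b) :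
    Coupled R (repeatM f n a) (repeatM g n b) := by
  induction n generalizing a b with
  | zero => exact .pure hab
  | succ n ih => exact (h a b hab).bind fun _ _ => ih

theorem run_invariant {O : Oracle σ} {P : Cfg σ → Prop}
    (htick : ∀ c k, P c → P (c.tick k))
    (hregs : ∀ (c : Cfg σ) (regs : Regs), P c →
      (∀ r, ∃ r', (regs r).length ≤ (c.regs r').length + 1) → P { c with regs, time := c.time + 1 })
    (hcall : ∀ (c : Cfg σ) (args : List ℕ) (res : ℕ), P c →
      ∀ a ∈ (O (args.map c.regs) c.env).support,
      P ((({ c with env := a.2 } : Cfg σ).set res a.1).tick (1 + totalLength (args.map c.regs))))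
    (p : Prog) {c d : Cfg σ} (hc : P c) (hd : d ∈ (p.run O c).support) : P d := by
  have hset (c : Cfg σ) (r : ℕ) (w : Word) (hc : P c)
      (hw : ∃ r', w.length ≤ (c.regs r').length + 1) : P ((c.set r w).tick 1) :=
    hregs c _ hc fun r' => by
      rcases eq_or_ne r' r with rfl | h
      · simpa using hw
      · exact ⟨r', by simp [h]⟩
  induction p generalizing c d with
  | skip => exact (PMF.mem_support_pure_iff _ _).1 hd ▸ htick _ _ hc
  | push r b => exact (PMF.mem_support_pure_iff _ _).1 hd ▸ hset _ _ _ hc ⟨r, le_rfl⟩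
  | pop r => exact (PMF.mem_support_pure_iff _ _).1 hd ▸ hset _ _ _ hc ⟨r, by simp; omega⟩
  | coin r =>
    obtain ⟨b, -, hd⟩ := (PMF.mem_support_bind_iff _ _ _).1 hd
    exact (PMF.mem_support_pure_iff _ _).1 hd ▸ hset _ _ _ hc ⟨r, le_rfl⟩
  | move dst src =>
    refine (PMF.mem_support_pure_iff _ _).1 hd ▸ hregs c _ hc fun r => ?_
    by_cases hdst : r = dst
    · exact ⟨src, by simp [Cfg.set, hdst]⟩
    · exact ⟨r, by simp only [Cfg.set, Function.update_apply, if_neg hdst]; split_ifs <;> simp⟩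
  | copy dst src =>
    obtain rfl := (PMF.mem_support_pure_iff _ _).1 hd
    simpa only [Cfg.tick, Nat.add_assoc] using
      htick _ (c.regs src).length (hset c dst _ hc ⟨src, Nat.le_succ _⟩)
  | call args res =>
    obtain ⟨a, ha, hd⟩ := (PMF.mem_support_bind_iff _ _ _).1 hd
    exact (PMF.mem_support_pure_iff _ _).1 hd ▸ hcall _ _ _ hc a ha
  | seq p q ihp ihq =>
    obtain ⟨e, he, hd⟩ := (PMF.mem_support_bind_iff _ _ _).1 hd
    exact ihq (ihp hc he) hd
  | ifTop r b p q ihp ihq =>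
    rw [Prog.run] at hd
    split at hd
    · exact ihp (htick _ _ hc) hd
    · exact ihq (htick _ _ hc) hd
  | loop r p ih => exact repeatM_invariant (fun _ ha _ hb => ih ha hb) _ (htick _ _ hc) hd

theorem le_time_of_mem_run {O : Oracle σ} {p : Prog} {c d : Cfg σ}
    (hd : d ∈ (p.run O c).support) : c.time ≤ d.time :=
  run_invariant (P := fun d => c.time ≤ d.time) (fun _ k h => h.trans (Nat.le_add_right _ k))
    (fun _ _ h _ => Nat.le_succ_of_le h) (fun _ _ _ h _ _ => Nat.le_add_right_of_le h) p le_rfl hd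

theorem length_le_of_mem_run {O : Oracle σ} {A T : ℕ}
    (hO : ∀ args s, totalLength args ≤ T → ∀ a ∈ (O args s).support, a.1.length ≤ A) {p : Prog}
    {c d : Cfg σ} (hc : ∀ r, (c.regs r).length ≤ A + c.time) (hd : d ∈ (p.run O c).support)
    (hT : d.time ≤ T) (r : ℕ) : (d.regs r).length ≤ A + d.time := by
  refine run_invariant (P := fun d => d.time ≤ T → ∀ r, (d.regs r).length ≤ A + d.time)
    (fun d k h hT r => ?_) (fun d regs h hr hT r => ?_) (fun d args res h a ha hT r => ?_) p
    (fun _ => hc) hd hT r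
  · have := h (le_of_add_le_left hT) r
    simp only [Cfg.tick_regs, Cfg.tick_time]
    omega
  · obtain ⟨r', hr⟩ := hr r
    exact hr.trans (Nat.succ_le_succ (h (Nat.le_of_succ_le hT) r'))
  · simp only [Cfg.tick_time, Cfg.set_time] at hT
    rcases eq_or_ne r res with rfl | hne
    · simpa using Nat.le_add_right_of_le (hO _ _ (by omega) a ha)
    · simpa [hne, Nat.add_assoc] using Nat.le_add_right_of_le (h (by omega) r)

end Run

section Simulation

variable {σ τ : Type}

namespace Prog

/-- A strict upper bound for the registers that a program mentions. -/
def width : Prog → ℕ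
  | skip => 0
  | push r _ | pop r | coin r => r + 1
  | move dst src | copy dst src => max (dst + 1) (src + 1)
  | call args res => max (res + 1) (args.foldr (fun r m => max (r + 1) m) 0)
  | seq p q => max p.width q.width
  | ifTop r _ p q => max (r + 1) (max p.width q.width)
  | loop r p => max (r + 1) p.width

theorem lt_width_of_mem_args {args : List ℕ} {res r : ℕ} (hr : r ∈ args) :
    r < (call args res).width := by
  refine lt_max_of_lt_right ?_
  induction args with
  | nil => cases hr
  | cons a args ih =>
    rcases List.mem_cons.1 hr with rfl | hr
    · exact lt_max_of_lt_left (Nat.lt_succ_self r)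
    · exact lt_max_of_lt_right (ih hr)

/-- The program `p` as a part of a larger program: `e` says where its registers are kept, and `h`
is the code that takes the place of its oracle calls. -/
def inline (e : ℕ → ℕ) (h : List ℕ → ℕ → Prog) : Prog → Prog
  | skip => skip
  | push r b => push (e r) b
  | pop r => pop (e r)
  | coin r => coin (e r)
  | move dst src => move (e dst) (e src)
  | copy dst src => copy (e dst) (e src)
  | call args res => h args res
  | seq p q => seq (p.inline e h) (q.inline e h)
  | ifTop r b p q => ifTop (e r) b (p.inline e h) (q.inline e h)
  | loop r p => loop (e r) (p.inline e h)

theorem inline_id_call (p : Prog) : p.inline id call = p := by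
  induction p with
  | seq p q ihp ihq => rw [inline, ihp, ihq]
  | ifTop r b p q ihp ihq => rw [inline, ihp, ihq]; rfl
  | loop r p ih => rw [inline, ih]; rfl
  | _ => rfl

end Prog

theorem Coupled.of_time_le {α : Type} {O : Oracle τ} {p : Prog} {d : Cfg τ} {T : ℕ}
    {μ : PMF α} {R : α → Cfg τ → Prop}
    (h : d.time ≤ T → Coupled (fun a d => d.time ≤ T → R a d) μ (p.run O d)) :
    Coupled (fun a d => d.time ≤ T → R a d) μ (p.run O d) := by
  by_cases hT : d.time ≤ T
  · exact h hT
  · exact (Coupled.product _ _).mono fun _ _ hsupp hT' =>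
      absurd ((le_time_of_mem_run hsupp.2).trans hT') hT

/-- The relation `R` between host and guest configurations is a simulation: a host with oracle `O`
keeps the first `m` registers of a guest with oracle `O'` in its registers `e r` and runs the code
`h` for the oracle calls that the guest completes by time `T`. -/
structure Simulation (O : Oracle σ) (O' : Oracle τ) (e : ℕ → ℕ) (h : List ℕ → ℕ → Prog) (m T : ℕ)
    (R : Cfg σ → Cfg τ → Prop) : Prop where
  regs_eq : ∀ {c d r}, R c d → r < m → c.regs (e r) = d.regs r
  set : ∀ {c d r} (w : Word), R c d → r < m → R (c.set (e r) w) (d.set r w)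
  tick : ∀ {c d} (k : ℕ), R c d → R (c.tick k) (d.tick k)
  call : ∀ {c d args res}, R c d → (∀ r ∈ args, r < m) → res < m →
    d.time + (1 + totalLength (args.map d.regs)) ≤ T →
    Coupled R ((h args res).run O c) ((Prog.call args res).run O' d)

theorem Simulation.coupled_run {O : Oracle σ} {O' : Oracle τ} {e : ℕ → ℕ}
    {h : List ℕ → ℕ → Prog} {m T : ℕ} {R : Cfg σ → Cfg τ → Prop} (S : Simulation O O' e h m T R)
    {p : Prog} (hp : p.width ≤ m) {c : Cfg σ} {d : Cfg τ} (hR : R c d) :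
    Coupled (fun c d => d.time ≤ T → R c d) ((p.inline e h).run O c) (p.run O' d) := by
  have hbit {c d r} (b : Bool) (hr : r + 1 ≤ m) (hR : R c d) :
      R ((c.set (e r) (b :: c.regs (e r))).tick 1) ((d.set r (b :: d.regs r)).tick 1) := by
    rw [S.regs_eq hR hr]
    exact S.tick 1 (S.set _ hR hr)
  induction p generalizing c d with
  | skip => exact .pure fun _ => S.tick 1 hR
  | push r b => exact .pure fun _ => hbit b hp hR
  | pop r =>
    simp only [Prog.inline, Prog.run, S.regs_eq hR hp]
    exact .pure fun _ => S.tick 1 (S.set _ hR hp)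
  | coin r =>
    exact (Coupled.refl _).bind fun b b' hb => .pure fun _ => hb ▸ hbit b hp hR
  | move dst src =>
    obtain ⟨hdst, hsrc⟩ := max_le_iff.1 hp
    simp only [Prog.inline, Prog.run, S.regs_eq hR hsrc]
    exact .pure fun _ => S.tick 1 (S.set _ (S.set [] hR hsrc) hdst)
  | copy dst src =>
    obtain ⟨hdst, hsrc⟩ := max_le_iff.1 hp
    simp only [Prog.inline, Prog.run, S.regs_eq hR hsrc]
    exact .pure fun _ => S.tick _ (S.set _ hR hdst)
  | call args res =>
    by_cases hT : d.time + (1 + totalLength (args.map d.regs)) ≤ T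
    · exact (S.call hR (fun r hr => (Prog.lt_width_of_mem_args hr).trans_le hp)
        (le_of_max_le_left hp) hT).mono fun _ _ hR _ => hR
    · refine (Coupled.product _ _).mono fun c' d' hsupp hT' => absurd hT' ?_
      obtain ⟨a, -, hd'⟩ := (PMF.mem_support_bind_iff _ _ _).1 hsupp.2
      rw [(PMF.mem_support_pure_iff _ _).1 hd']
      exact hT
  | seq p q ihp ihq =>
    obtain ⟨hp, hq⟩ := max_le_iff.1 hp
    exact (ihp hp hR).bind fun c d hR => .of_time_le fun hT => ihq hq (hR hT)
  | ifTop r b p q ihp ihq =>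
    simp only [Prog.width, max_le_iff] at hp
    simp only [Prog.inline, Prog.run, S.regs_eq hR hp.1]
    split
    · exact ihp hp.2.1 (S.tick 1 hR)
    · exact ihq hp.2.2 (S.tick 1 hR)
  | loop r p ih =>
    obtain ⟨hr, hp⟩ := max_le_iff.1 hp
    simp only [Prog.inline, Prog.run, S.regs_eq hR hr]
    exact .repeatM (fun c d hR => .of_time_le fun hT => ih hp (hR hT)) _ fun _ => S.tick _ hR

theorem run_coupled {O : Oracle σ} {O' : Oracle τ} {E : ℕ → σ → τ → Prop} {T : ℕ}
    (hE : ∀ {k k' s t}, k ≤ k' → E k s t → E k' s t)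
    (hO : ∀ {k s t} (args : List Word), k + (1 + totalLength args) ≤ T → E k s t →
      Coupled (fun a b => a.1 = b.1 ∧ E (k + (1 + totalLength args)) a.2 b.2)
        (O args s) (O' args t))
    (p : Prog) {c : Cfg σ} {d : Cfg τ} (hregs : c.regs = d.regs) (htime : c.time = d.time)
    (henv : E d.time c.env d.env) :
    Coupled (fun c d => d.time ≤ T → c.regs = d.regs ∧ c.time = d.time ∧ E d.time c.env d.env)
      (p.run O c) (p.run O' d) := by
  have S : Simulation O O' id Prog.call p.width T
      fun c d => c.regs = d.regs ∧ c.time = d.time ∧ E d.time c.env d.env :=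
    { regs_eq := fun hR _ => congrFun hR.1 _
      set := fun w hR _ => ⟨by simp [hR.1], hR.2⟩
      tick := fun k hR => ⟨hR.1, by simp [hR.2.1], hE (Nat.le_add_right _ k) hR.2.2⟩
      call := fun {c d args res} hR _ _ hT => by
        obtain ⟨hregs, htime, hR⟩ := hR
        simp only [Prog.run, hregs]
        exact (hO _ hT hR).bind fun a b hab =>
          .pure ⟨by simp [hab.1], by simp [htime], hab.2⟩ }
  simpa only [Prog.inline_id_call] using S.coupled_run le_rfl ⟨hregs, htime, henv⟩

end Simulation

section Block

variable {σ τ : Type}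

theorem inline_coupled {O : Oracle σ} {O' : Oracle τ} {p : Prog} {e : ℕ → ℕ}
    (he : Function.Injective e) {h : List ℕ → ℕ → Prog} {m F T : ℕ} {I : Regs → σ → τ → Prop}
    (hp : p.width ≤ m) (hF : 0 < F)
    (hset : ∀ {regs s t} r w, I regs s t → I (Function.update regs (e r) w) s t)
    (hcall : ∀ {c : Cfg σ} {t} (args : List ℕ) (res : ℕ), I c.regs c.env t →
      totalLength (args.map fun r => c.regs (e r)) ≤ T →
      Coupled (fun c' a => (∀ r, c'.regs (e r) = Function.update c.regs (e res) a.1 (e r)) ∧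
          I c'.regs c'.env a.2 ∧
          c'.time ≤ c.time + F * (1 + totalLength (args.map fun r => c.regs (e r))))
        ((h args res).run O c) (O' (args.map fun r => c.regs (e r)) t))
    {inputs : List Word} (hT : p.TimeBound inputs T) {c : Cfg σ} {t : τ}
    (hinputs : ∀ r < m, c.regs (e r) = inputs.getD r []) (hI : I c.regs c.env t) :
    Coupled (fun c' d => (∀ r < m, c'.regs (e r) = d.regs r) ∧ I c'.regs c'.env d.env ∧
        c'.time ≤ c.time + F * T)
      ((p.inline e h).run O c) (p.run O' (Cfg.start inputs t)) := by
  have S : Simulation O O' e h m T fun c' d => (∀ r < m, c'.regs (e r) = d.regs r) ∧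
      I c'.regs c'.env d.env ∧ c'.time ≤ c.time + F * d.time :=
    { regs_eq := fun hR => hR.1 _
      set := fun w hR _ => by
        refine ⟨fun r hr => ?_, hset _ _ hR.2.1, hR.2.2⟩
        simp only [Cfg.set_regs, Function.update_apply, he.eq_iff, hR.1 r hr]
      tick := fun k hR => ⟨hR.1, hR.2.1, by
        simp only [Cfg.tick_time, Nat.mul_add]
        exact (Nat.add_le_add hR.2.2 (Nat.le_mul_of_pos_left k hF)).trans_eq (Nat.add_assoc _ _ _)⟩
      call := fun {c' d args res} hR hargs _ hT' => by
        have hmap : (args.map fun r => c'.regs (e r)) = args.map d.regs :=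
          List.map_congr_left fun r hr => hR.1 r (hargs r hr)
        have := hcall args res hR.2.1 (by rw [hmap]; omega)
        rw [hmap] at this
        refine this.map_right fun c'' a ⟨hregs, hI, htime⟩ => ⟨fun r hr => ?_, hI, ?_⟩
        · simp only [hregs, Cfg.tick_regs, Cfg.set_regs, Function.update_apply, he.eq_iff,
            hR.1 r hr]
        · simp only [Cfg.tick_time, Cfg.set_time, Nat.mul_add] at htime ⊢
          omega }
  refine (S.coupled_run hp ⟨hinputs, hI, Nat.le_add_right _ _⟩).mono_support
    fun c' _ d hd hR => ?_
  have htime := hT τ O' t d hd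
  obtain ⟨hregs, hI, hle⟩ := hR htime
  exact ⟨hregs, hI, hle.trans (by gcongr)⟩

end Block

/-- The registers of the reduction: the registers `adv r`, `sim r` and `alg r` of the adversary, of
the simulator and of the algorithms of the proof system, and registers for the data that they
exchange and for the choice of the hybrid. -/
inductive Slot : Type
  | secParam | params | limit
  | simState | message | answer | selector | buffer | base | rounds | power | bit
  | counter | statement | witness | proof | verdict | trash
  | adv (r : ℕ) | sim (r : ℕ) | alg (r : ℕ)

namespace Slot

/-- The register of a slot. The inputs of the reduction are in `secParam` and `params`, its output
is left in `secParam`. -/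
def addr : Slot → ℕ
  | secParam => 0
  | params => 1
  | limit => 2
  | simState => 3
  | message => 4
  | answer => 5
  | selector => 6
  | buffer => 7
  | base => 8
  | rounds => 9
  | power => 10
  | bit => 11
  | counter => 12
  | statement => 13
  | witness => 14
  | proof => 15
  | verdict => 16
  | trash => 17
  | adv r => 18 + 3 * r
  | sim r => 19 + 3 * r
  | alg r => 20 + 3 * r

instance : Coe Slot ℕ := ⟨addr⟩

theorem addr_injective : Function.Injective addr := by
  intro s t h
  cases s <;> cases t <;> simp only [addr, adv.injEq, sim.injEq, alg.injEq] at h ⊢ <;> omega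

@[simp] theorem addr_inj {s t : Slot} : (s : ℕ) = t ↔ s = t := addr_injective.eq_iff

/-- The level of the code that may change a slot: code of level `ℓ` leaves the slots of lower level
alone. Activations of the simulator have level `1`, the prover level `2`, and the algorithms of the
proof system level `3`. -/
def level : Slot → ℕ
  | secParam | params | limit | adv _ => 0
  | simState | message | answer | selector | buffer | base | rounds | power | bit | sim _ => 1
  | counter | statement | witness | proof | verdict => 2
  | trash | alg _ => 3

end Slot

open Slot

/-- The slots of level below `ℓ` have the same contents in both memories. -/
def Frame (ℓ : ℕ) (regs regs' : Regs) : Prop := ∀ s : Slot, s.level < ℓ → regs' s = regs s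

namespace Frame

variable {ℓ ℓ' : ℕ} {regs regs' regs'' : Regs} {s : Slot}

theorem refl (ℓ : ℕ) (regs : Regs) : Frame ℓ regs regs := fun _ _ => rfl

theorem trans (h : Frame ℓ regs regs') (h' : Frame ℓ regs' regs'') : Frame ℓ regs regs'' :=
  fun s hs => (h' s hs).trans (h s hs)

theorem mono (h : Frame ℓ regs regs') (hℓ : ℓ' ≤ ℓ) : Frame ℓ' regs regs' :=
  fun s hs => h s (hs.trans_le hℓ)

theorem update_right (h : Frame ℓ regs regs') (hs : ℓ ≤ s.level) (w : Word) :
    Frame ℓ regs (Function.update regs' s w) := fun t ht => by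
  have hts : t ≠ s := by rintro rfl; omega
  simpa [hts] using h t ht

end Frame

section Clear

variable {σ : Type} {O : Oracle σ}

/-- Empty the slots of a list. -/
def clear : List Slot → Prog
  | [] => .skip
  | s :: l => .seq (.move trash s) (clear l)

theorem run_clear {l : List Slot} (hl : trash ∉ l) (c : Cfg σ) :
    ∃ c', (clear l).run O c = PMF.pure c' ∧ (∀ s ∈ l, c'.regs s = []) ∧
      (∀ s ∉ trash :: l, c'.regs s = c.regs s) ∧ c'.env = c.env ∧
      c'.time = c.time + (l.length + 1) := by
  induction l generalizing c with
  | nil => exact ⟨c.tick 1, rfl, by simp, by simp, rfl, rfl⟩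
  | cons s l ih =>
    obtain ⟨hs, hl⟩ : trash ≠ s ∧ trash ∉ l := by simpa using hl
    obtain ⟨c', hrun, hempty, hregs, henv, htime⟩ :=
      ih hl (((c.set s []).set trash (c.regs s)).tick 1)
    refine ⟨c', ?_, fun t ht => ?_, fun t ht => ?_, henv, ?_⟩
    · simp only [clear, Prog.run, PMF.pure_bind, hrun]
    · by_cases htl : t ∈ l
      · exact hempty t htl
      · obtain rfl : t = s := by simpa [htl] using ht
        rw [hregs t (by simp [htl, hs.symm])]
        simp [hs.symm]
    · simp only [List.mem_cons, not_or] at ht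
      rw [hregs t (by simp [ht])]
      simp [ht]
    · simp only [htime, Cfg.tick_time, Cfg.set_time, List.length_cons]
      omega

/-- Copy the contents of the slots of a list to `e i`, `e (i + 1)`, … -/
def copyTo (e : ℕ → Slot) : ℕ → List Slot → Prog
  | _, [] => .skip
  | i, s :: l => .seq (.copy (e i) s) (copyTo e (i + 1) l)

theorem run_copyTo {e : ℕ → Slot} (he : Function.Injective e) {l : List Slot}
    (hl : ∀ s ∈ l, ∀ r, s ≠ e r) (i : ℕ) (c : Cfg σ) :
    ∃ c', (copyTo e i l).run O c = PMF.pure c' ∧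
      (∀ r, c'.regs (e r) = if r < i then c.regs (e r) else
        (l.map fun s : Slot => c.regs s).getD (r - i) (c.regs (e r))) ∧
      (∀ s : Slot, (∀ r, s ≠ e r) → c'.regs s = c.regs s) ∧ c'.env = c.env ∧
      c'.time = c.time + (l.length + 1 + totalLength (l.map fun s : Slot => c.regs s)) := by
  induction l generalizing i c with
  | nil => exact ⟨c.tick 1, rfl, by simp, by simp, rfl, rfl⟩
  | cons s l ih =>
    simp only [List.forall_mem_cons] at hl
    obtain ⟨c', hrun, hblock, hregs, henv, htime⟩ :=
      ih hl.2 (i + 1) ((c.set (e i) (c.regs s)).tick (1 + (c.regs s).length))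
    have hmap : (l.map fun t : Slot => Function.update c.regs (e i) (c.regs s) t) =
        l.map fun t : Slot => c.regs t :=
      List.map_congr_left fun t ht => by simp [hl.2 t ht i]
    simp only [Cfg.tick_regs, Cfg.set_regs, hmap] at hblock hregs htime
    refine ⟨c', by simp only [copyTo, Prog.run, PMF.pure_bind, hrun], fun r => ?_,
      fun t ht => by simp [hregs t ht, ht i], henv, ?_⟩
    · rw [hblock]
      rcases lt_trichotomy r i with hr | rfl | hr
      · simp [hr, hr.trans (Nat.lt_succ_self i), he.ne hr.ne]
      · simp
      · obtain ⟨k, rfl⟩ := Nat.exists_eq_add_of_lt hr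
        have hk : i + (k + 1) - (i + 1) = k := by omega
        simp [he.eq_iff, Nat.add_assoc, hk]
    · simp only [htime, Cfg.tick_time, Cfg.set_time, List.length_cons, totalLength, List.map_cons,
        List.sum_cons]
      omega

/-- Empty the first `m` slots of a block and copy the contents of the slots of a list to it. -/
def load (e : ℕ → Slot) (m : ℕ) (l : List Slot) : Prog :=
  .seq (clear ((List.range m).map e)) (copyTo e 0 l)

theorem run_load {e : ℕ → Slot} (he : Function.Injective e) (htrash : ∀ r, e r ≠ trash)
    {l : List Slot} (hl : ∀ s ∈ l, s ≠ trash ∧ ∀ r, s ≠ e r) (m : ℕ) (c : Cfg σ) :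
    ∃ c', (load e m l).run O c = PMF.pure c' ∧
      (∀ r < m, c'.regs (e r) = (l.map fun s : Slot => c.regs s).getD r []) ∧
      (∀ s : Slot, s ≠ trash → (∀ r, s ≠ e r) → c'.regs s = c.regs s) ∧ c'.env = c.env ∧
      c'.time = c.time + (m + l.length + 2 + totalLength (l.map fun s : Slot => c.regs s)) := by
  obtain ⟨c₁, hrun₁, hempty, hregs₁, henv₁, htime₁⟩ :=
    run_clear (O := O) (l := (List.range m).map e) (by simp [htrash]) c
  obtain ⟨c₂, hrun₂, hblock, hregs₂, henv₂, htime₂⟩ :=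
    run_copyTo (O := O) he (fun s hs => (hl s hs).2) 0 c₁
  have hkeep {s : Slot} (hs : s ≠ trash) (hse : ∀ r, s ≠ e r) : c₁.regs s = c.regs s :=
    hregs₁ s (by simp [hs, fun r => (hse r).symm])
  have hmap : (l.map fun s : Slot => c₁.regs s) = l.map fun s : Slot => c.regs s :=
    List.map_congr_left fun s hs => hkeep (hl s hs).1 (hl s hs).2
  refine ⟨c₂, by simp only [load, Prog.run, hrun₁, PMF.pure_bind, hrun₂], fun r hr => ?_,
    fun s hs hse => (hregs₂ s hse).trans (hkeep hs hse), henv₂.trans henv₁, ?_⟩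
  · simp [hblock, hmap, hempty _ (List.mem_map_of_mem (List.mem_range.2 hr))]
  · simp only [htime₂, htime₁, hmap, List.length_map, List.length_range]
    omega

end Clear

section Algorithm

variable {σ : Type} {O : Oracle σ}

/-- Run the algorithm `p` on the contents of the slots `a`, `b` and `d`, with output in `dst`. The
oracle calls that `p` does not need are answered by the empty string. -/
def runAlg (p : Prog) (a b d dst : Slot) : Prog :=
  .seq (load alg (max 3 p.width) [a, b, d]) <|
    .seq (p.inline (fun r => alg r) fun _ res => .move trash (alg res)) (.move dst (alg 0))

theorem runAlg_coupled {p : Prog} {a b d dst : Slot} {c : Cfg σ} {T : ℕ} (ha : a.level < 3)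
    (hb : b.level < 3) (hd : d.level < 3)
    (hT : p.TimeBound [c.regs a, c.regs b, c.regs d] T) :
    Coupled (fun c' w => Frame 3 (Function.update c.regs dst w) c'.regs ∧ c'.env = c.env ∧
        c'.time ≤ c.time + (p.width + 9 + totalLength [c.regs a, c.regs b, c.regs d] + T))
      ((runAlg p a b d dst).run O c) (p.out [c.regs a, c.regs b, c.regs d]) := by
  have hlow {s : Slot} (hs : s.level < 3) : s ≠ trash ∧ ∀ r, s ≠ alg r :=
    ⟨by rintro rfl; simp [level] at hs, by rintro r rfl; simp [level] at hs⟩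
  obtain ⟨c₁, hrun, hblock, hregs, henv, htime⟩ := run_load (O := O) (e := alg) (l := [a, b, d])
    (fun r r' h => by simpa using h) (by simp) (by simp [hlow ha, hlow hb, hlow hd])
    (max 3 p.width) c
  have hcoupled := inline_coupled (O := O) (O' := noOracle) (p := p) (e := fun r => alg r)
    (h := fun _ res => .move trash (alg res)) (F := 1)
    (I := fun regs s _ => Frame 3 c.regs regs ∧ s = c.env)
    (fun r r' h => by simpa using h) (le_max_right 3 p.width) one_pos
    (fun r w hI => ⟨hI.1.update_right le_rfl w, hI.2⟩)
    (fun {c' _} args res hI _ => .pure ⟨fun r => by simp [Function.update_apply],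
      ⟨(hI.1.update_right le_rfl _).update_right le_rfl _, hI.2⟩, by simp⟩)
    hT hblock (t := ()) ⟨fun s hs => hregs s (hlow hs).1 (hlow hs).2, henv⟩
  simp only [runAlg, Prog.run, hrun, PMF.pure_bind]
  refine hcoupled.bind fun c₂ d ⟨hout, ⟨hframe, henv⟩, htime'⟩ => .pure ⟨fun s hs => ?_, henv, ?_⟩
  · by_cases hsd : s = dst <;>
      simp [hsd, (hlow hs).2 0, hout 0 (by simp), hframe s hs]
  · simp only [Cfg.tick_time, Cfg.set_time, htime, List.length_cons, List.length_nil, List.map_cons,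
      List.map_nil] at htime' ⊢
    omega

end Algorithm

section Bounds

theorem polynomial_eval_monotone (f : Polynomial ℕ) : Monotone fun m => f.eval m := by
  intro a b hab
  simp only [Polynomial.eval_eq_sum_range]
  gcongr

theorem Prog.TimeBound.mono {p : Prog} {inputs : List Word} {t t' : ℕ}
    (h : p.TimeBound inputs t) (htt' : t ≤ t') : p.TimeBound inputs t' :=
  fun σ O s c hc => (h σ O s c hc).trans htt'

theorem length_getD_le_totalLength (l : List Word) (i : ℕ) :
    (l.getD i []).length ≤ totalLength l := by
  by_cases hi : i < l.length
  · rw [List.getD_eq_getElem _ _ hi]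
    exact List.single_le_sum (by simp) _ (List.mem_map_of_mem (List.getElem_mem hi))
  · rw [List.getD_eq_default _ _ (not_lt.1 hi)]
    exact Nat.zero_le _

theorem totalLength_cons_getD_le (a : Word) (l : List Word) :
    totalLength [a, l.getD 0 [], l.getD 1 []] ≤ 2 * (a.length + totalLength l) := by
  have h₀ := length_getD_le_totalLength l 0
  have h₁ := length_getD_le_totalLength l 1
  simp only [totalLength, List.map_cons, List.map_nil, List.sum_cons, List.sum_nil] at h₀ h₁ ⊢
  omega

theorem length_le_of_mem_out {p : Prog} {inputs : List Word} {T : ℕ} (hp : p.TimeBound inputs T)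
    {w : Word} (hw : w ∈ (p.out inputs).support) : w.length ≤ totalLength inputs + T := by
  obtain ⟨c, hc, rfl⟩ := (PMF.mem_support_map_iff _ _ _).1 hw
  have htime := hp _ _ _ c hc
  have hlength := length_le_of_mem_run (A := totalLength inputs)
    (fun _ _ _ a ha => by simp [(PMF.mem_support_pure_iff _ _).1 ha])
    (length_getD_le_totalLength inputs) hc htime 0
  exact hlength.trans (Nat.add_le_add_left htime _)

theorem NIZK.exists_timeBound (N : NIZK) : ∃ F : Polynomial ℕ, ∀ (inputs : List Word) (m : ℕ),
    totalLength inputs ≤ m → N.decideRel.TimeBound inputs (F.eval m) ∧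
      N.prove.TimeBound inputs (F.eval m) ∧ N.rand.TimeBound inputs (F.eval m) := by
  obtain ⟨f, hf⟩ := N.decideRel_ppt
  obtain ⟨g, hg⟩ := N.prove_ppt
  obtain ⟨h, hh⟩ := N.rand_ppt
  refine ⟨f + g + h, fun inputs m hm => ⟨(hf inputs).mono ?_, (hg inputs).mono ?_,
    (hh inputs).mono ?_⟩⟩ <;> simp only [Polynomial.eval_add]
  · linarith [polynomial_eval_monotone f hm]
  · linarith [polynomial_eval_monotone g hm]
  · linarith [polynomial_eval_monotone h hm]

end Bounds

section Prover

variable {σ : Type} {O : Oracle σ}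

/-- Copy the `i`-th argument of an oracle call of the program in the block `e` to `dst`. -/
def copyArg (e : ℕ → Slot) (dst : Slot) (args : List ℕ) (i : ℕ) : Prog :=
  match args[i]? with
  | some r => .copy dst (e r)
  | none => .move trash dst

theorem run_copyArg {e : ℕ → Slot} {dst : Slot} (hdst : dst ≠ trash) (args : List ℕ) (i : ℕ)
    (c : Cfg σ) :
    ∃ c', (copyArg e dst args i).run O c = PMF.pure c' ∧
      Frame 3 (Function.update c.regs dst ((args.map fun r => c.regs (e r)).getD i [])) c'.regs ∧
      c'.env = c.env ∧ c'.time ≤ c.time + (1 + totalLength (args.map fun r => c.regs (e r))) := by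
  have hlength := length_getD_le_totalLength (args.map fun r => c.regs (e r)) i
  unfold copyArg
  cases hi : args[i]? with
  | none =>
    refine ⟨_, rfl, fun s hs => ?_, rfl, by simp⟩
    have hs : s ≠ trash := by rintro rfl; simp [level] at hs
    by_cases hsd : s = dst <;> simp [hi, hs, hsd, hdst]
  | some r =>
    refine ⟨_, rfl, ?_, rfl, ?_⟩
    · simpa [hi] using Frame.refl 3 _
    · simpa [hi] using hlength

/-- The treatment of a proof `π` of `x` by the prover of the reduction, which has a counter and the
state of the challenge oracle `O` as its state: the proof is submitted as the challenge if the
counter is about to reach zero, randomized before that moment, and left alone after it. -/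
def NIZK.treatProof (N : NIZK) (O : Oracle σ) (pp x w π : Word) :
    ℕ × σ → PMF (Word × (ℕ × σ))
  | (0, s) => PMF.pure (π, (0, s))
  | (1, s) => (O [x, w, π] s).map fun a => (a.1, (0, a.2))
  | (i + 2, s) => (N.rand.out [pp, x, π]).map fun π' => (π', (i + 1, s))

/-- The prover of the reduction: it randomizes the first proofs, uses its challenge for the next
one, and leaves the later ones alone. -/
def NIZK.gameProver (N : NIZK) (O : Oracle σ) (pp : Word) : Oracle (ℕ × σ) := fun args s =>
  let x := args.getD 0 []
  let w := args.getD 1 []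
  if N.rel pp x w = true then (N.prove.out [pp, x, w]).bind fun π => N.treatProof O pp x w π s
  else PMF.pure ([], s)

/-- The code for `NIZK.treatProof`, with the counter in unary. -/
def treatCode (N : NIZK) : Prog :=
  .ifTop counter none .skip <| .seq (.pop counter) <|
    .ifTop counter none (.call [statement, witness, proof] proof)
      (runAlg N.rand params statement proof proof)

theorem treatCode_coupled {N : NIZK} {c : Cfg σ} {s : ℕ × σ} {T : ℕ}
    (hT : N.rand.TimeBound [c.regs params, c.regs statement, c.regs proof] T)
    (hcounter : c.regs counter = unary s.1) (henv : c.env = s.2) :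
    Coupled (fun c' a => Frame 2 c.regs c'.regs ∧ c'.regs proof = a.1 ∧
        c'.regs counter = unary a.2.1 ∧ c'.env = a.2.2 ∧
        c'.time ≤ c.time + (N.rand.width + 12 + T +
          totalLength [c.regs params, c.regs statement, c.regs witness, c.regs proof]))
      ((treatCode N).run O c)
      (N.treatProof O (c.regs params) (c.regs statement) (c.regs witness) (c.regs proof) s) := by
  obtain ⟨i, s⟩ := s
  obtain rfl : c.env = s := henv
  rcases i with _ | _ | i
  · simp only [treatCode, Prog.run, hcounter, unary, NIZK.treatProof]
    exact .pure ⟨.refl _ _, rfl, hcounter, rfl, by simp; omega⟩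
  · have hrun : (treatCode N).run O c =
        (O [c.regs statement, c.regs witness, c.regs proof] c.env).bind fun a =>
          PMF.pure ⟨Function.update (Function.update c.regs counter []) proof a.1, a.2,
            c.time + 3 + (1 + totalLength [c.regs statement, c.regs witness, c.regs proof])⟩ := by
      simp [treatCode, Prog.run, hcounter, unary, Cfg.set, Cfg.tick]
    rw [hrun]
    refine (Coupled.refl _).bind fun a _ hab => .pure ?_
    refine hab ▸ ⟨?_, by simp, by simp [unary], rfl, ?_⟩
    · exact ((Frame.refl 2 _).update_right (by decide) _).update_right (by decide) _
    · simp only [totalLength, List.map_cons, List.sum_cons]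
      omega
  · have hrun : (treatCode N).run O c = (runAlg N.rand params statement proof proof).run O
        ⟨Function.update c.regs counter (unary (i + 1)), c.env, c.time + 3⟩ := by
      simp [treatCode, Prog.run, hcounter, unary, Cfg.set, Cfg.tick]
    have hrand := runAlg_coupled (O := O) (p := N.rand) (a := params) (b := statement) (d := proof)
      (dst := proof) (T := T)
      (c := ⟨Function.update c.regs counter (unary (i + 1)), c.env, c.time + 3⟩)
      (by decide) (by decide) (by decide) (by simpa using hT)
    simp only [ne_eq, addr_inj, reduceCtorEq, not_false_eq_true, Function.update_of_ne] at hrand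
    rw [hrun]
    refine hrand.map_right fun c' a ⟨hframe, henv, htime⟩ => ⟨?_, ?_, ?_, henv, ?_⟩
    · exact (((Frame.refl 2 _).update_right (by decide) _).update_right (by decide) _).trans
        (hframe.mono (by decide))
    · simp [hframe proof (by decide)]
    · simp [hframe counter (by decide)]
    · simp only [totalLength, List.map_cons, List.sum_cons] at htime ⊢
      omega

/-- The code that makes a proof of `statement` and treats it. -/
def proofCode (N : NIZK) : Prog :=
  .seq (runAlg N.prove params statement witness proof) (treatCode N)

theorem proofCode_coupled {N : NIZK} {c : Cfg σ} {s : ℕ × σ} {T : ℕ → ℕ} {u v : ℕ}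
    (hprove : ∀ inputs m, totalLength inputs ≤ m → N.prove.TimeBound inputs (T m))
    (hrand : ∀ inputs m, totalLength inputs ≤ m → N.rand.TimeBound inputs (T m))
    (hu : totalLength [c.regs params, c.regs statement, c.regs witness] ≤ u)
    (hv : 2 * u + T u ≤ v)
    (hcounter : c.regs counter = unary s.1) (henv : c.env = s.2) :
    Coupled (fun c' a => Frame 2 c.regs c'.regs ∧ c'.regs proof = a.1 ∧
        c'.regs counter = unary a.2.1 ∧ c'.env = a.2.2 ∧
        c'.time ≤ c.time + (N.prove.width + N.rand.width + 21 + u + T u + v + T v))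
      ((proofCode N).run O c)
      ((N.prove.out [c.regs params, c.regs statement, c.regs witness]).bind fun π =>
        N.treatProof O (c.regs params) (c.regs statement) (c.regs witness) π s) := by
  have hproof := runAlg_coupled (O := O) (c := c) (dst := proof) (by decide) (by decide) (by decide)
    (hprove _ u hu)
  refine (hproof.mono_support (S := fun c' π => _ ∧ _ ∧ _ ∧ π.length ≤ u + T u)
    fun c' _ π hπ h => ⟨h.1, h.2.1, h.2.2, (length_le_of_mem_out (hprove _ u hu) hπ).trans
      (Nat.add_le_add_right hu _)⟩).bind fun c₁ π ⟨hframe, henv₁, htime, hπ⟩ => ?_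
  have hparams : c₁.regs params = c.regs params := by simp [hframe params (by decide)]
  have hstatement : c₁.regs statement = c.regs statement := by
    simp [hframe statement (by decide)]
  have hwitness : c₁.regs witness = c.regs witness := by simp [hframe witness (by decide)]
  have hproof : c₁.regs proof = π := by simp [hframe proof (by decide)]
  simp only [totalLength, List.map_cons, List.map_nil, List.sum_cons, List.sum_nil] at hu htime
  have htreat := treatCode_coupled (N := N) (O := O) (c := c₁) (s := s)
    (hrand _ v (by
      simp only [totalLength, hparams, hstatement, hproof, List.map_cons, List.map_nil,
        List.sum_cons, List.sum_nil]
      omega))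
    (by simp [hframe counter (by decide), hcounter]) (henv₁.trans henv)
  rw [hparams, hstatement, hwitness, hproof] at htreat
  refine htreat.mono fun c' a ⟨hframe', hproof', hcounter', henv', htime'⟩ =>
    ⟨fun t ht => ?_, hproof', hcounter', henv', ?_⟩
  · have htp : t ≠ proof := by rintro rfl; simp [level] at ht
    simp [hframe' t ht, hframe t (ht.trans (by decide)), htp]
  · simp only [totalLength, List.map_cons, List.map_nil, List.sum_cons, List.sum_nil] at htime'
    omega

/-- Copy the arguments of an oracle call of the simulator to `statement` and `witness`. -/
def fetchCode (args : List ℕ) : Prog :=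
  .seq (copyArg sim statement args 0) (copyArg sim witness args 1)

theorem run_fetchCode (args : List ℕ) (c : Cfg σ) :
    ∃ c', (fetchCode args).run O c = PMF.pure c' ∧ Frame 2 c.regs c'.regs ∧
      c'.regs counter = c.regs counter ∧
      c'.regs statement = (args.map fun r => c.regs (sim r)).getD 0 [] ∧
      c'.regs witness = (args.map fun r => c.regs (sim r)).getD 1 [] ∧ c'.env = c.env ∧
      c'.time ≤ c.time + 2 * (1 + totalLength (args.map fun r => c.regs (sim r))) := by
  obtain ⟨c₁, hrun₁, hframe₁, henv₁, htime₁⟩ :=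
    run_copyArg (O := O) (e := sim) (dst := statement) (by simp) args 0 c
  obtain ⟨c₂, hrun₂, hframe₂, henv₂, htime₂⟩ :=
    run_copyArg (O := O) (e := sim) (dst := witness) (by simp) args 1 c₁
  have hargs : (args.map fun r => c₁.regs (sim r)) = args.map fun r => c.regs (sim r) :=
    List.map_congr_left fun r _ => by simp [hframe₁ (sim r) (by simp [level])]
  rw [hargs] at hframe₂ htime₂
  refine ⟨c₂, by simp only [fetchCode, Prog.run, hrun₁, PMF.pure_bind, hrun₂], ?_, ?_, ?_, ?_,
    henv₂.trans henv₁, by omega⟩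
  · exact (((Frame.refl 2 _).update_right (by decide) _).trans (hframe₁.mono (by decide))).trans
      (((Frame.refl 2 _).update_right (by decide) _).trans (hframe₂.mono (by decide)))
  · simp [hframe₂ counter (by decide), hframe₁ counter (by decide)]
  · simp [hframe₂ statement (by decide), hframe₁ statement (by decide)]
  · simp [hframe₂ witness (by decide)]

/-- Decide whether the arguments of an oracle call of the simulator belong to the relation. -/
def decideCode (N : NIZK) (args : List ℕ) : Prog :=
  .seq (fetchCode args) (runAlg N.decideRel params statement witness verdict)

theorem decideCode_coupled {N : NIZK} {c : Cfg σ} {ws : List Word} {T : ℕ → ℕ} {u : ℕ}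
    (hdecide : ∀ inputs m, totalLength inputs ≤ m → N.decideRel.TimeBound inputs (T m))
    {args : List ℕ} (hws : (args.map fun r => c.regs (sim r)) = ws)
    (hu : 2 * ((c.regs params).length + totalLength ws) ≤ u) :
    Coupled (fun c' b => Frame 2 c.regs c'.regs ∧ c'.regs counter = c.regs counter ∧
        c'.regs statement = ws.getD 0 [] ∧ c'.regs witness = ws.getD 1 [] ∧
        c'.regs verdict = [b] ∧ c'.env = c.env ∧
        c'.time ≤ c.time + (N.decideRel.width + 11 + 2 * u + T u))
      ((decideCode N args).run O c)
      (PMF.pure (N.rel (c.regs params) (ws.getD 0 []) (ws.getD 1 []))) := by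
  obtain ⟨c₁, hrun₁, hframe₁, hcounter₁, hstatement, hwitness, henv₁, htime₁⟩ :=
    run_fetchCode (O := O) args c
  rw [hws] at hstatement hwitness htime₁
  have hparams := hframe₁ params (by decide)
  have htotal := (totalLength_cons_getD_le (c.regs params) ws).trans hu
  have hrel := runAlg_coupled (O := O) (c := c₁) (p := N.decideRel) (a := params) (b := statement)
    (d := witness) (dst := verdict) (T := T u) (by decide) (by decide) (by decide)
    (by rw [hparams, hstatement, hwitness]; exact hdecide _ u htotal)
  rw [N.decideRel_out, hparams, hstatement, hwitness] at hrel
  simp only [decideCode, Prog.run, hrun₁, PMF.pure_bind]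
  rw [← PMF.bind_pure (Prog.run O _ c₁)]
  refine hrel.pure_bind fun c₂ ⟨hframe₂, henv₂, htime₂⟩ => .pure ⟨fun t ht => ?_, ?_, ?_, ?_, ?_,
    henv₂.trans henv₁, by omega⟩
  · have htv : t ≠ verdict := by rintro rfl; simp [level] at ht
    simp [hframe₂ t (ht.trans (by decide)), htv, hframe₁ t ht]
  · simp [hframe₂ counter (by decide), hcounter₁]
  · simp [hframe₂ statement (by decide), hstatement]
  · simp [hframe₂ witness (by decide), hwitness]
  · simp [hframe₂ verdict (by decide)]

/-- The code for an oracle call of the simulator to `NIZK.gameProver`. -/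
def proverCode (N : NIZK) (args : List ℕ) (res : ℕ) : Prog :=
  .seq (decideCode N args) <|
    .ifTop verdict (some true) (.seq (proofCode N) (.move (sim res) proof)) (.move trash (sim res))

theorem proverCode_coupled {N : NIZK} {c : Cfg σ} {s : ℕ × σ} {ws : List Word} {T : ℕ → ℕ}
    {u v : ℕ} (hT : ∀ inputs m, totalLength inputs ≤ m → N.decideRel.TimeBound inputs (T m) ∧
      N.prove.TimeBound inputs (T m) ∧ N.rand.TimeBound inputs (T m))
    {args : List ℕ} (hws : (args.map fun r => c.regs (sim r)) = ws) (res : ℕ)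
    (hu : 2 * ((c.regs params).length + totalLength ws) ≤ u)
    (hv : 2 * u + T u ≤ v) (hcounter : c.regs counter = unary s.1) (henv : c.env = s.2) :
    Coupled (fun c' a => Frame 2 (Function.update c.regs (sim res) a.1) c'.regs ∧
        c'.regs counter = unary a.2.1 ∧ c'.env = a.2.2 ∧
        c'.time ≤ c.time + (N.decideRel.width + N.prove.width + N.rand.width + 34 +
          3 * u + 2 * T u + v + T v))
      ((proverCode N args res).run O c) (N.gameProver O (c.regs params) ws s) := by
  refine (decideCode_coupled (fun _ m hm => (hT _ m hm).1) hws hu).pure_bind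
    fun c₁ ⟨hframe, hcounter₁, hstatement, hwitness, hverdict, henv₁, htime⟩ => ?_
  have hparams := hframe params (by decide)
  simp only [Prog.run, hverdict, NIZK.gameProver, List.head?_cons, Option.some.injEq]
  split_ifs with hrel
  · have htotal := (totalLength_cons_getD_le (c.regs params) ws).trans hu
    have hproof := proofCode_coupled (O := O) (c := c₁.tick 1) (s := s)
      (fun _ m hm => (hT _ m hm).2.1) (fun _ m hm => (hT _ m hm).2.2) (u := u) (v := v)
      (by simpa only [Cfg.tick_regs, hparams, hstatement, hwitness] using htotal) hv
      (hcounter₁.trans hcounter) (henv₁.trans henv)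
    simp only [Cfg.tick_regs, Cfg.tick_time, hparams, hstatement, hwitness] at hproof
    refine hproof.bind_left fun c₂ a ⟨hframe₂, hproof₂, hcounter₂, henv₂, htime₂⟩ =>
      .pure ⟨fun t ht => ?_, by simpa using hcounter₂, henv₂, ?_⟩
    · have htp : t ≠ proof := by rintro rfl; simp [level] at ht
      by_cases hts : t = sim res <;> simp [hts, hproof₂, hframe₂ t ht, hframe t ht, htp]
    · simp only [Cfg.tick_time, Cfg.set_time]
      omega
  · refine .pure ⟨fun t ht => ?_, by simpa using hcounter₁.trans hcounter, henv₁.trans henv, ?_⟩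
    · have htt : t ≠ trash := by rintro rfl; simp [level] at ht
      by_cases hts : t = sim res <;> simp [hts, htt, hframe t ht]
    · simp only [Cfg.tick_time, Cfg.set_time]
      omega

theorem exists_proverCode_coupled (N : NIZK) : ∃ F : Polynomial ℕ, ∀ {σ : Type} {O : Oracle σ}
    {c : Cfg σ} {s : ℕ × σ} {args : List ℕ} {ws : List Word}
    (_ : (args.map fun r => c.regs (sim r)) = ws) (res : ℕ),
    c.regs counter = unary s.1 → c.env = s.2 →
    Coupled (fun c' a => Frame 2 (Function.update c.regs (sim res) a.1) c'.regs ∧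
        c'.regs counter = unary a.2.1 ∧ c'.env = a.2.2 ∧
        c'.time ≤ c.time + F.eval ((c.regs params).length + totalLength ws))
      ((proverCode N args res).run O c) (N.gameProver O (c.regs params) ws s) := by
  obtain ⟨T, hT⟩ := N.exists_timeBound
  let U : Polynomial ℕ := 2 * Polynomial.X
  let V : Polynomial ℕ := 2 * U + T.comp U
  refine ⟨Polynomial.C (N.decideRel.width + N.prove.width + N.rand.width + 34) + 3 * U +
    2 * T.comp U + V + T.comp V, fun hws res hcounter henv => ?_⟩
  refine (proverCode_coupled hT hws res le_rfl le_rfl hcounter henv).mono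
    fun c' a ⟨hframe, hcounter', henv', htime⟩ => ⟨hframe, hcounter', henv', htime.trans_eq ?_⟩
  simp [U, V, Polynomial.eval_comp]

end Prover

section Activation

variable {σ τ : Type} {O : Oracle σ}

/-- An activation of the simulator with a prover that has a state: the answer, the new state of the
simulator, and the new state of the prover. -/
def activateFrom (P : Oracle τ) (code : Prog) (inputs : List Word) (s : τ) :
    PMF (Word × Word × τ) :=
  (code.run P (Cfg.start inputs s)).map fun c => (c.regs 0, c.regs 1, c.env)

/-- The oracle that the adversary faces, if the prover `P` has a state. -/
def Simulator.statefulOracle (D : Simulator) (P : Oracle τ) (n : ℕ) (pp : Word) :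
    Oracle (Word × τ) := fun args s =>
  activateFrom P (if args.getD 0 [] = [true] then D.issue else D.request)
    [unary n, pp, s.1, args.getD 1 []] s.2

/-- A time bound for all activations of a simulator with given parameters. -/
def Simulator.TimeBound (D : Simulator) (n : ℕ) (pp : Word) (T : ℕ) : Prop :=
  D.keyGen.TimeBound [unary n, pp] T ∧ ∀ st msg : Word,
    D.request.TimeBound [unary n, pp, st, msg] T ∧ D.issue.TimeBound [unary n, pp, st, msg] T ∧
    D.showPhase.TimeBound [unary n, pp, st, msg] T

/-- The reduction keeps the state of the simulator and the state of `NIZK.gameProver`. -/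
def Keeps (regs : Regs) (env : σ) (s : Word × ℕ × σ) : Prop :=
  regs simState = s.1 ∧ regs counter = unary s.2.1 ∧ env = s.2.2

/-- Load the inputs of an activation of the simulator, whose code uses `k` registers. -/
def loadSim (k : ℕ) : Prog :=
  .seq (load sim (max 4 k) [secParam, params]) <|
    .seq (.move (sim 2) simState) (.move (sim 3) message)

theorem run_loadSim (k : ℕ) (c : Cfg σ) : ∃ c', (loadSim k).run O c = PMF.pure c' ∧
    (∀ r < max 4 k, c'.regs (sim r) = [c.regs secParam, c.regs params, c.regs simState,
      c.regs message].getD r []) ∧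
    Frame 1 c.regs c'.regs ∧ c'.regs counter = c.regs counter ∧ c'.env = c.env ∧
    c'.time ≤ c.time + (k + 10 + (c.regs secParam).length + (c.regs params).length) := by
  obtain ⟨c', hrun, hblock, hregs, henv, htime⟩ := run_load (O := O) (e := sim)
    (l := [secParam, params]) (fun r r' h => by simpa using h) (by simp) (by simp) (max 4 k) c
  refine ⟨((((c'.set simState []).set (sim 2) (c'.regs simState)).tick 1).set message []).set
    (sim 3) (c'.regs message) |>.tick 1, by simp [loadSim, Prog.run, hrun], fun r hr => ?_,
    fun s hs => ?_, ?_, henv, ?_⟩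
  · match r with
    | 0 | 1 => simp [hblock]
    | 2 | 3 => simp [hregs]
    | r + 4 => simp [hblock _ hr]
  · have hlow {t : Slot} (ht : 1 ≤ t.level) : s ≠ t := by rintro rfl; omega
    have hsim (r : ℕ) : s ≠ sim r := hlow (by simp [level])
    simp [hsim, hlow (t := simState) (by decide), hlow (t := message) (by decide),
      hregs s (hlow (by decide)) hsim]
  · simp [hregs]
  · simp only [Cfg.tick_time, Cfg.set_time, htime, totalLength, List.map_cons, List.map_nil,
      List.sum_cons, List.sum_nil, List.length_cons, List.length_nil]
    omega

/-- An activation of the simulator with the code `code`, on the message in `message`. -/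
def activationCode (N : NIZK) (code : Prog) : Prog :=
  .seq (loadSim code.width) <| .seq (code.inline (fun r => sim r) (proverCode N)) <|
    .seq (.move answer (sim 0)) (.move simState (sim 1))

theorem exists_activationCode_coupled (N : NIZK) (code : Prog) :
    ∃ G : Polynomial ℕ, ∀ {σ : Type} {O : Oracle σ} {c : Cfg σ} {s : Word × ℕ × σ} {m : ℕ},
    (c.regs secParam).length ≤ m → (c.regs params).length ≤ m →
    code.TimeBound [c.regs secParam, c.regs params, s.1, c.regs message] m →
    Keeps c.regs c.env s →
    Coupled (fun c' a => Frame 1 c.regs c'.regs ∧ c'.regs answer = a.1 ∧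
        Keeps c'.regs c'.env a.2 ∧ c'.time ≤ c.time + G.eval m)
      ((activationCode N code).run O c)
      (activateFrom (N.gameProver O (c.regs params)) code
        [c.regs secParam, c.regs params, s.1, c.regs message] s.2) := by
  obtain ⟨F, hF⟩ := exists_proverCode_coupled N
  refine ⟨Polynomial.C (code.width + 12) + 2 * Polynomial.X +
    (F.comp (2 * Polynomial.X) + 1) * Polynomial.X,
    fun {σ O c s m} hn hpp hT ⟨hstate, hcounter, henv⟩ => ?_⟩
  obtain ⟨c₁, hrun, hblock, hframe, hcounter₁, henv₁, htime⟩ :=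
    run_loadSim (O := O) code.width c
  have hsim := inline_coupled (O := O) (O' := N.gameProver O (c.regs params)) (p := code)
    (e := fun r => sim r) (h := proverCode N) (F := F.eval (2 * m) + 1) (T := m) (c := c₁)
    (t := s.2) (I := fun regs env t => Frame 1 c.regs regs ∧ regs counter = unary t.1 ∧ env = t.2)
    (fun r r' h => by simpa using h) (le_max_right 4 code.width) (Nat.succ_pos _)
    (fun r w hI => ⟨hI.1.update_right le_rfl w, by simpa using hI.2.1, hI.2.2⟩)
    (fun {c' t} args res ⟨hframe', hcounter', henv'⟩ hargs => by
      have hparams := hframe' params (by decide)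
      have hprover := hF (O := O) rfl res hcounter' henv' (args := args)
      rw [hparams] at hprover
      refine hprover.mono fun c'' a ⟨hframe'', hcounter'', henv'', htime''⟩ =>
        ⟨fun r => hframe'' (sim r) (by simp [level]), ⟨?_, hcounter'', henv''⟩, ?_⟩
      · exact (hframe'.update_right le_rfl _).trans (hframe''.mono (by decide))
      · refine htime''.trans (Nat.add_le_add_left ?_ _)
        have := polynomial_eval_monotone F
          (Nat.add_le_add hpp hargs |>.trans_eq (two_mul m).symm)
        dsimp only at this
        nlinarith)
    hT (by rwa [hstate] at hblock) ⟨hframe, hcounter₁.trans hcounter, henv₁.trans henv⟩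
  simp only [activationCode, Prog.run, hrun, PMF.pure_bind]
  refine hsim.bind fun c₂ d ⟨hout, ⟨hframe₂, hcounter₂, henv₂⟩, htime₂⟩ => .pure
    ⟨?_, by simp [hout], ⟨by simp [hout], by simpa using hcounter₂, henv₂⟩, ?_⟩
  · exact (((hframe₂.update_right (by decide) _).update_right (by decide) _).update_right
      (by decide) _).update_right (by decide) _
  · simp only [Cfg.tick_time, Cfg.set_time, Polynomial.eval_add, Polynomial.eval_mul,
      Polynomial.eval_C, Polynomial.eval_X, Polynomial.eval_comp, Polynomial.eval_ofNat,
      Polynomial.eval_one]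
    omega

/-- Run `p` if `selector` holds the string `1`, and `q` otherwise. -/
def selectCode (p q : Prog) : Prog :=
  .ifTop selector (some true) (.seq (.pop selector) (.ifTop selector none p q)) q

theorem run_selectCode (p q : Prog) (c : Cfg σ) : ∃ c',
    (selectCode p q).run O c = (if c.regs selector = [true] then p else q).run O c' ∧
    (∀ s : Slot, s ≠ selector → c'.regs s = c.regs s) ∧ c'.env = c.env ∧ c'.time ≤ c.time + 3 := by
  rcases hc : c.regs selector with _ | ⟨_ | _, _ | ⟨b, w⟩⟩
  · exact ⟨c.tick 1, by simp [selectCode, Prog.run, hc], by simp, rfl, by simp⟩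
  · exact ⟨c.tick 1, by simp [selectCode, Prog.run, hc], by simp, rfl, by simp⟩
  · exact ⟨c.tick 1, by simp [selectCode, Prog.run, hc], by simp, rfl, by simp⟩
  · exact ⟨(((c.tick 1).set selector []).tick 1).tick 1, by simp [selectCode, Prog.run, hc],
      fun s hs => by simp [hs], rfl, by simp⟩
  · exact ⟨(((c.tick 1).set selector (b :: w)).tick 1).tick 1,
      by simp [selectCode, Prog.run, hc], fun s hs => by simp [hs], rfl, by simp⟩

/-- Fetch the message of a query of the adversary, and run `p` or `q`, as the selector says. -/
def dispatchCode (p q : Prog) (args : List ℕ) : Prog :=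
  .seq (copyArg adv selector args 0) (.seq (copyArg adv message args 1) (selectCode p q))

theorem run_dispatchCode (p q : Prog) (args : List ℕ) (c : Cfg σ) {ws : List Word}
    (hws : (args.map fun r => c.regs (adv r)) = ws) : ∃ c',
    (dispatchCode p q args).run O c = (if ws.getD 0 [] = [true] then p else q).run O c' ∧
    c'.regs message = ws.getD 1 [] ∧ Frame 1 c.regs c'.regs ∧
    (∀ s, Keeps c.regs c.env s → Keeps c'.regs c'.env s) ∧
    c'.time ≤ c.time + (5 + 2 * totalLength ws) := by
  obtain ⟨c₁, hrun₁, hframe₁, henv₁, htime₁⟩ :=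
    run_copyArg (O := O) (e := adv) (dst := selector) (by simp) args 0 c
  obtain ⟨c₂, hrun₂, hframe₂, henv₂, htime₂⟩ :=
    run_copyArg (O := O) (e := adv) (dst := message) (by simp) args 1 c₁
  obtain ⟨c₃, hrun₃, hregs₃, henv₃, htime₃⟩ := run_selectCode (O := O) p q c₂
  have hargs : (args.map fun r => c₁.regs (adv r)) = ws :=
    hws ▸ List.map_congr_left fun r _ => by simp [hframe₁ (adv r) (by simp [level])]
  rw [hws] at hframe₁ htime₁
  rw [hargs] at hframe₂ htime₂
  have hregs {t : Slot} (ht : t.level < 3) (hts : t ≠ selector) (htm : t ≠ message) :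
      c₃.regs t = c.regs t := by simp [hregs₃ t hts, hframe₂ t ht, hframe₁ t ht, hts, htm]
  have hselector : c₂.regs selector = ws.getD 0 [] := by
    simp [hframe₂ selector (by decide), hframe₁ selector (by decide)]
  refine ⟨c₃, by simp only [dispatchCode, Prog.run, hrun₁, hrun₂, hrun₃, PMF.pure_bind, hselector],
    by simp [hregs₃ message (by simp), hframe₂ message (by decide)], fun t ht => ?_,
    fun s hs => ?_, by omega⟩
  · exact hregs (ht.trans (by decide)) (by rintro rfl; simp [level] at ht)
      (by rintro rfl; simp [level] at ht)
  · unfold Keeps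
    rwa [hregs (by decide) (by simp) (by simp), hregs (by decide) (by simp) (by simp), henv₃,
      henv₂, henv₁]

/-- The code for a query of the adversary to the simulator. -/
def queryCode (N : NIZK) (D : Simulator) (args : List ℕ) (res : ℕ) : Prog :=
  .seq (dispatchCode (activationCode N D.issue) (activationCode N D.request) args)
    (.move (adv res) answer)

theorem exists_queryCode_coupled (N : NIZK) (D : Simulator) :
    ∃ G : Polynomial ℕ, ∀ {σ : Type} {O : Oracle σ} {c : Cfg σ} {s : Word × ℕ × σ} {n m : ℕ}
      {args : List ℕ} {ws : List Word} (_ : (args.map fun r => c.regs (adv r)) = ws) (res : ℕ),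
    c.regs secParam = unary n → n ≤ m → (c.regs params).length ≤ m →
    D.TimeBound n (c.regs params) m → Keeps c.regs c.env s →
    Coupled (fun c' a => Frame 1 (Function.update c.regs (adv res) a.1) c'.regs ∧
        Keeps c'.regs c'.env a.2 ∧ c'.time ≤ c.time + (6 + 2 * totalLength ws + G.eval m))
      ((queryCode N D args res).run O c)
      (D.statefulOracle (N.gameProver O (c.regs params)) n (c.regs params) ws s) := by
  obtain ⟨G₁, hG₁⟩ := exists_activationCode_coupled N D.issue
  obtain ⟨G₂, hG₂⟩ := exists_activationCode_coupled N D.request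
  refine ⟨G₁ + G₂, fun {σ O c s n m args ws} hws res hn hnm hpp hT hs => ?_⟩
  obtain ⟨c₁, hrun, hmessage, hframe, hkeeps, htime⟩ := run_dispatchCode (O := O)
    (activationCode N D.issue) (activationCode N D.request) args c hws
  have hsecParam := (hframe secParam (by decide)).trans hn
  have hparams := hframe params (by decide)
  have hactivation : Coupled (fun c' a => Frame 1 c₁.regs c'.regs ∧ c'.regs answer = a.1 ∧
      Keeps c'.regs c'.env a.2 ∧ c'.time ≤ c₁.time + (G₁ + G₂).eval m)
      ((if ws.getD 0 [] = [true] then activationCode N D.issue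
        else activationCode N D.request).run O c₁)
      (D.statefulOracle (N.gameProver O (c.regs params)) n (c.regs params) ws s) := by
    have hlength : (c₁.regs secParam).length ≤ m := by simpa [hsecParam, unary] using hnm
    have hT' := hT.2 s.1 (c₁.regs message)
    rw [← hsecParam, ← hparams] at hT'
    rw [Simulator.statefulOracle, ← hsecParam, ← hparams, ← hmessage, Polynomial.eval_add]
    split_ifs
    · refine (hG₁ hlength (hparams ▸ hpp) hT'.2.1 (hkeeps s hs)).mono
        fun c' a h => ⟨h.1, h.2.1, h.2.2.1, h.2.2.2.trans (by omega)⟩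
    · refine (hG₂ hlength (hparams ▸ hpp) hT'.1 (hkeeps s hs)).mono
        fun c' a h => ⟨h.1, h.2.1, h.2.2.1, h.2.2.2.trans (by omega)⟩
  simp only [queryCode, Prog.run, hrun]
  refine hactivation.bind_left fun c₂ a ⟨hframe₂, hanswer, hkeeps₂, htime₂⟩ => .pure
    ⟨fun t ht => ?_, by simpa [Keeps] using hkeeps₂, ?_⟩
  · have hta : t ≠ answer := by rintro rfl; simp [level] at ht
    by_cases htr : t = adv res <;> simp [htr, hta, hanswer, hframe₂ t ht, hframe t ht]
  · simp only [Cfg.tick_time, Cfg.set_time]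
    omega

end Activation

section Loops

variable {σ : Type} {O : Oracle σ}

theorem run_loop_push (s dst : Slot) (c : Cfg σ) :
    (Prog.loop s (.push dst true)).run O c = PMF.pure
      ⟨Function.update c.regs dst (unary (c.regs s).length ++ c.regs dst), c.env,
        c.time + (1 + 2 * (c.regs s).length)⟩ := by
  have hrepeat (q : ℕ) (c : Cfg σ) : repeatM ((Prog.push dst true).run O) q c = PMF.pure
      ⟨Function.update c.regs dst (unary q ++ c.regs dst), c.env, c.time + q⟩ := by
    induction q generalizing c with
    | zero => simp [repeatM, unary]
    | succ q ih =>
      rw [repeatM, Prog.run, PMF.pure_bind, ih]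
      simp [unary, List.replicate_succ', Nat.add_assoc, Nat.add_comm 1]
  rw [Prog.run, hrepeat]
  simp only [Cfg.tick_regs, Cfg.tick_env, Cfg.tick_time, Nat.add_assoc, two_mul]

/-- Append `L ^ k` bits to `dst`, where `L` is the length of `s`. -/
def pushPow (s dst : Slot) : ℕ → Prog
  | 0 => .push dst true
  | k + 1 => .loop s (pushPow s dst k)

theorem exists_run_pushPow {s dst : Slot} (hs : s ≠ dst) {L : ℕ} (hL : 2 ≤ L) (k : ℕ) :
    ∃ t, t + 3 ≤ 4 * L ^ k ∧ ∀ c : Cfg σ, (c.regs s).length = L →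
      (pushPow s dst k).run O c = PMF.pure
        ⟨Function.update c.regs dst (unary (L ^ k) ++ c.regs dst), c.env, c.time + t⟩ := by
  induction k with
  | zero => exact ⟨1, by simp, fun _ _ => rfl⟩
  | succ k ih =>
    obtain ⟨t, ht, hrun⟩ := ih
    have hrepeat (q : ℕ) {c : Cfg σ} (hc : (c.regs s).length = L) :
        repeatM ((pushPow s dst k).run O) q c = PMF.pure
          ⟨Function.update c.regs dst (unary (q * L ^ k) ++ c.regs dst), c.env,
            c.time + q * t⟩ := by
      induction q generalizing c with
      | zero => simp [repeatM, unary]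
      | succ q ih =>
        rw [repeatM, hrun c hc, PMF.pure_bind, ih (by simpa [hs] using hc)]
        simp [unary, Nat.add_mul, Nat.add_assoc, Nat.add_comm t, ← List.append_assoc]
    refine ⟨1 + L + L * t, ?_, fun c hc => ?_⟩
    · rw [pow_succ']
      nlinarith
    · rw [pushPow, Prog.run, hrepeat _ (by simpa using hc), hc, pow_succ']
      simp [Nat.add_assoc]

/-- Move the first bit of `src` to `dst`, if there is one. -/
def moveBit (src dst : Slot) : Prog :=
  .ifTop src (some true) (.seq (.pop src) (.push dst true)) <|
    .ifTop src (some false) (.seq (.pop src) (.push dst false)) .skip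

theorem run_loop_moveBit {s src dst : Slot} (hs : src ≠ dst) (c : Cfg σ) :
    ∃ t ≤ 1 + 5 * (c.regs s).length, (Prog.loop s (moveBit src dst)).run O c = PMF.pure
      ⟨Function.update (Function.update c.regs src ((c.regs src).drop (c.regs s).length)) dst
        (((c.regs src).take (c.regs s).length).reverse ++ c.regs dst), c.env, c.time + t⟩ := by
  have hbit (c : Cfg σ) : ∃ t ≤ 4, (moveBit src dst).run O c = PMF.pure
      ⟨Function.update (Function.update c.regs src (c.regs src).tail) dst
        (((c.regs src).take 1).reverse ++ c.regs dst), c.env, c.time + t⟩ := by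
    rcases hc : c.regs src with _ | ⟨_ | _, w⟩
    · refine ⟨3, by simp, ?_⟩
      have hsrc : Function.update c.regs src [] = c.regs := by rw [← hc, Function.update_eq_self]
      simp [moveBit, Prog.run, hc, Cfg.tick, hsrc]
    · exact ⟨4, by simp, by simp [moveBit, Prog.run, hc, Cfg.tick, Cfg.set, hs.symm]⟩
    · exact ⟨3, by simp, by simp [moveBit, Prog.run, hc, Cfg.tick, Cfg.set, hs.symm]⟩
  have hrepeat (q : ℕ) (c : Cfg σ) : ∃ t ≤ 4 * q, repeatM ((moveBit src dst).run O) q c = PMF.pure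
      ⟨Function.update (Function.update c.regs src ((c.regs src).drop q)) dst
        (((c.regs src).take q).reverse ++ c.regs dst), c.env, c.time + t⟩ := by
    induction q generalizing c with
    | zero => exact ⟨0, le_rfl, by simp [repeatM]⟩
    | succ q ih =>
      obtain ⟨t, ht, hrun⟩ := hbit c
      obtain ⟨t', ht', hrun'⟩ := ih ⟨Function.update (Function.update c.regs src (c.regs src).tail)
        dst (((c.regs src).take 1).reverse ++ c.regs dst), c.env, c.time + t⟩
      refine ⟨t + t', by omega, ?_⟩
      rw [repeatM, hrun, PMF.pure_bind, hrun']
      have hcomm (v w : Word) (regs : Regs) :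
          Function.update (Function.update regs dst v) src w =
            Function.update (Function.update regs src w) dst v :=
        Function.update_comm (addr_injective.ne hs.symm) v w regs
      rcases c.regs src with _ | ⟨b, w⟩ <;> simp [hs, hcomm, Nat.add_assoc]
  obtain ⟨t, ht, hrun⟩ := hrepeat (c.regs s).length (c.tick (1 + (c.regs s).length))
  exact ⟨1 + (c.regs s).length + t, by omega, by simp [Prog.run, hrun, Nat.add_assoc]⟩

end Loops

section Setup

variable {σ : Type} {O : Oracle σ}

/-- Prepare the registers: the security parameter `n` is put in unary form, `limit` and `rounds` get
`(n + 2) ^ a` and `(n + 2) ^ b` bits, and the counter of the hybrid is `1`. -/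
def initCode (a b : ℕ) : Prog :=
  .seq (clear [base, limit, rounds, power, counter, simState, message]) <|
    .seq (.loop secParam (.push base true)) <| .seq (.copy secParam base) <|
      .seq (.push base true) <| .seq (.push base true) <| .seq (pushPow base limit a) <|
        .seq (pushPow base rounds b) <| .seq (.push power true) (.push counter true)

theorem run_initCode (a b : ℕ) {c : Cfg σ} {n : ℕ} (hn : (c.regs secParam).length = n) :
    ∃ c', (initCode a b).run O c = PMF.pure c' ∧ c'.regs secParam = unary n ∧
      c'.regs params = c.regs params ∧ c'.regs limit = unary ((n + 2) ^ a) ∧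
      c'.regs rounds = unary ((n + 2) ^ b) ∧ c'.regs power = [true] ∧ c'.regs message = [] ∧
      Keeps c'.regs c'.env ([], 1, c.env) ∧
      c'.time ≤ c.time + (14 + 3 * n + 4 * (n + 2) ^ a + 4 * (n + 2) ^ b) := by
  obtain ⟨c₁, hrun₁, hempty, hregs, henv, htime⟩ := run_clear (O := O)
    (l := [base, limit, rounds, power, counter, simState, message]) (by simp) c
  simp only [List.forall_mem_cons] at hempty
  obtain ⟨hbase, hlimit, hrounds, hpower, hcounter, hstate, hmessage, -⟩ := hempty
  have hsecParam : (c₁.regs secParam).length = n := by rwa [hregs _ (by simp)]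
  obtain ⟨t, ht, hpow⟩ := exists_run_pushPow (σ := σ) (O := O) (s := base) (dst := limit)
    (by simp) (Nat.le_add_left 2 n) a
  obtain ⟨t', ht', hpow'⟩ := exists_run_pushPow (σ := σ) (O := O) (s := base) (dst := rounds)
    (by simp) (Nat.le_add_left 2 n) b
  rw [initCode, Prog.run, hrun₁, PMF.pure_bind, Prog.run, run_loop_push, PMF.pure_bind, hsecParam,
    hbase, Prog.run, Prog.run, PMF.pure_bind, Prog.run, Prog.run, PMF.pure_bind, Prog.run, Prog.run,
    PMF.pure_bind, Prog.run, hpow _ (by simp [unary]), PMF.pure_bind, Prog.run,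
    hpow' _ (by simp [unary]), PMF.pure_bind, Prog.run, Prog.run, PMF.pure_bind, Prog.run]
  refine ⟨_, rfl, by simp, by simp [hregs], by simp [hlimit], by simp [hrounds], by simp [hpower],
    by simpa, ⟨by simpa, by simp [hcounter, unary], henv⟩, ?_⟩
  simp only [htime, unary, Function.update_self, List.append_nil, List.length_replicate,
    List.length_cons, List.length_nil, Cfg.tick_time, Cfg.set_time]
  omega

/-- Cut the content of `answer` to the length of `limit`. -/
def truncateCode : Prog :=
  .seq (.move trash buffer) <| .seq (.loop limit (moveBit answer buffer)) <|
    .seq (.move trash answer) (.loop limit (moveBit buffer answer))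

theorem run_truncateCode (c : Cfg σ) :
    ∃ c', truncateCode.run O c = PMF.pure c' ∧
      c'.regs answer = (c.regs answer).take (c.regs limit).length ∧
      (∀ s ∉ [answer, buffer, trash], c'.regs s = c.regs s) ∧ c'.env = c.env ∧
      c'.time ≤ c.time + (4 + 10 * (c.regs limit).length) := by
  obtain ⟨t, ht, hrun⟩ := run_loop_moveBit (O := O) (s := limit) (src := answer) (dst := buffer)
    (by simp) (((c.set buffer []).set trash (c.regs buffer)).tick 1)
  rw [truncateCode, Prog.run, Prog.run, PMF.pure_bind, Prog.run, hrun, PMF.pure_bind, Prog.run,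
    Prog.run, PMF.pure_bind]
  obtain ⟨t', ht', hrun'⟩ := run_loop_moveBit (O := O) (s := limit) (src := buffer) (dst := answer)
    (by simp) _
  rw [hrun']
  refine ⟨_, rfl, by simp [List.take_of_length_le], fun s hs => ?_, rfl, ?_⟩
  · simp only [List.mem_cons, List.not_mem_nil, or_false, not_or] at hs
    simp [hs]
  · simp only [Cfg.tick_regs, Cfg.set_regs, ne_eq, addr_inj, reduceCtorEq, not_false_eq_true,
      Function.update_of_ne, Function.update_self, List.append_nil, Cfg.tick_env, Cfg.set_env,
      Cfg.tick_time, Cfg.set_time] at ht ht' ⊢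
    omega

end Setup

section Sampling

variable {σ : Type} {O : Oracle σ}

/-- A uniformly distributed number below `2 ^ k`. -/
def uniformBelow : ℕ → PMF ℕ
  | 0 => PMF.pure 0
  | k + 1 => (uniformBelow k).bind fun i =>
      (PMF.uniformOfFintype Bool).map fun b => i + b.toNat * 2 ^ k

/-- Add the length of `power` to the number in `counter` if `bit` starts with `1`. -/
def addDigit : Prog :=
  .ifTop bit (some true) (.loop power (.push counter true)) .skip

/-- Add a random binary digit to the number in `counter`, unless `rounds` is used up. -/
def sampleRound : Prog :=
  .ifTop rounds none .skip <| .seq (.coin bit) <|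
    .seq addDigit (.loop power (.seq (.push power true) (.pop rounds)))

/-- If `rounds` has `M` bits, add to `counter` a random number below the first power of `2` that
exceeds `M`. -/
def sampleCode : Prog := .loop rounds sampleRound

/-- The registers when `k` binary digits have been chosen, which make up the number `i`. -/
def SampleInvariant (M : ℕ) (c : Cfg σ) (k : ℕ) (c' : Cfg σ) (i : ℕ) : Prop :=
  c'.regs counter = unary (i + 1) ∧ c'.regs power = unary (2 ^ k) ∧
    c'.regs rounds = unary (M + 1 - 2 ^ k) ∧
    (∀ s ∉ [bit, counter, power, rounds], c'.regs s = c.regs s) ∧ c'.env = c.env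

theorem run_loop_double (c : Cfg σ) :
    (Prog.loop power (.seq (.push power true) (.pop rounds))).run O c = PMF.pure
      ⟨Function.update (Function.update c.regs power
          (unary (c.regs power).length ++ c.regs power))
        rounds ((c.regs rounds).drop (c.regs power).length), c.env,
        c.time + (1 + 3 * (c.regs power).length)⟩ := by
  have hrepeat (q : ℕ) (c : Cfg σ) :
      repeatM ((Prog.seq (.push power true) (.pop rounds)).run O) q c = PMF.pure
        ⟨Function.update (Function.update c.regs power (unary q ++ c.regs power)) rounds
          ((c.regs rounds).drop q), c.env, c.time + 2 * q⟩ := by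
    induction q generalizing c with
    | zero => simp [repeatM, unary]
    | succ q ih =>
      rw [repeatM, Prog.run, Prog.run, PMF.pure_bind, Prog.run, PMF.pure_bind, ih]
      have hcomm (v w : Word) (regs : Regs) :
          Function.update (Function.update regs rounds v) power w =
            Function.update (Function.update regs power w) rounds v :=
        Function.update_comm (addr_injective.ne (by simp)) v w regs
      simp [unary, List.replicate_succ', Nat.add_assoc, hcomm, Nat.mul_add, Nat.add_comm 2]
  rw [Prog.run, hrepeat]
  simp only [Cfg.tick_regs, Cfg.tick_env, Cfg.tick_time, Nat.add_assoc]
  congr 3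
  omega

theorem exists_run_addDigit {c : Cfg σ} {b : Bool} {i q : ℕ} (hbit : (c.regs bit).head? = some b)
    (hcounter : c.regs counter = unary (i + 1)) (hpower : c.regs power = unary q) :
    ∃ t ≤ 2 + 2 * q, addDigit.run O c = PMF.pure
      ⟨Function.update c.regs counter (unary (i + b.toNat * q + 1)), c.env, c.time + t⟩ := by
  rcases b with _ | _
  · refine ⟨2, by omega, ?_⟩
    have hregs : Function.update c.regs counter (unary (i + 1)) = c.regs := by
      rw [← hcounter, Function.update_eq_self]
    rw [addDigit, Prog.run, if_neg (by simp [hbit]), Prog.run]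
    simp [hregs, Cfg.tick, Nat.add_assoc]
  · refine ⟨1 + (1 + 2 * q), by omega, ?_⟩
    have hsum : q + (i + 1) = i + (q + 1) := by omega
    rw [addDigit, Prog.run, if_pos (by simp [hbit]), run_loop_push]
    simp only [Cfg.tick_regs, Cfg.tick_env, Cfg.tick_time, hcounter, hpower, unary, hsum,
      List.length_replicate, List.replicate_append_replicate, Bool.toNat_true, one_mul,
      Nat.add_assoc]

theorem sampleRound_coupled {M k i : ℕ} {c c' : Cfg σ} (h : SampleInvariant M c k c' i)
    (hk : 2 ^ k ≤ M) : Coupled (fun c'' j => SampleInvariant M c (k + 1) c'' j ∧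
      c''.time ≤ c'.time + (6 + 5 * 2 ^ k)) (sampleRound.run O c')
      ((PMF.uniformOfFintype Bool).map fun b => i + b.toNat * 2 ^ k) := by
  obtain ⟨hcounter, hpower, hrounds, hregs, henv⟩ := h
  have hactive : (c'.regs rounds).head? ≠ none := by
    rw [hrounds, Ne, List.head?_eq_none_iff, unary, List.replicate_eq_nil_iff]
    omega
  have hpow : M + 1 - 2 ^ k - 2 ^ k = M + 1 - 2 ^ (k + 1) := by omega
  rw [sampleRound, Prog.run, if_neg hactive, Prog.run, Prog.run, PMF.bind_bind, PMF.map]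
  refine (Coupled.refl _).bind fun b _ hb => ?_
  subst hb
  set d : Cfg σ := ((c'.tick 1).set bit (b :: (c'.tick 1).regs bit)).tick 1 with hd
  obtain ⟨t, ht, hrun⟩ := exists_run_addDigit (O := O) (c := d) (b := b) (i := i) (q := 2 ^ k)
    (by simp [hd]) (by simpa [hd]) (by simpa [hd])
  rw [PMF.pure_bind, Prog.run, hrun, PMF.pure_bind, run_loop_double]
  refine .pure ⟨⟨by simp, ?_, ?_, fun s hs => ?_, henv⟩, ?_⟩
  · simp [hd, hpower, unary, pow_succ, mul_two]
  · simp [hd, hpower, hrounds, unary, hpow]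
  · simp only [List.mem_cons, List.not_mem_nil, or_false, not_or] at hs
    simp [hd, hs, hregs s]
  · simp [hd, hpower, unary]
    omega

theorem sampleCode_coupled {M : ℕ} {c : Cfg σ} (hcounter : c.regs counter = [true])
    (hpower : c.regs power = [true]) (hrounds : c.regs rounds = unary M) :
    Coupled (fun c' i => c'.regs counter = unary (i + 1) ∧
        (∀ s ∉ [bit, counter, power, rounds], c'.regs s = c.regs s) ∧ c'.env = c.env ∧
        c'.time ≤ c.time + (1 + 17 * M))
      (sampleCode.run O c) (uniformBelow M.size) := by
  have hrepeat (j : ℕ) : Coupled (fun c' i => SampleInvariant M c (min j M.size) c' i ∧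
      c'.time + 5 ≤ c.time + (1 + M) + (6 * j + 5 * 2 ^ min j M.size))
      (repeatM (sampleRound.run O) j (c.tick (1 + M))) (uniformBelow (min j M.size)) := by
    induction j with
    | zero =>
      refine .pure ⟨⟨hcounter, hpower, ?_, fun _ _ => rfl, rfl⟩, by simp⟩
      simpa using hrounds
    | succ j ih =>
      rw [repeatM_succ_right]
      rcases lt_or_ge j M.size with hj | hj
      · rw [min_eq_left hj.le] at ih
        rw [min_eq_left (Nat.succ_le_of_lt hj)]
        refine ih.bind fun c' i ⟨h, htime⟩ => ?_
        refine (sampleRound_coupled h (Nat.lt_size.1 hj)).mono fun c'' i' ⟨h', htime'⟩ => ⟨h', ?_⟩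
        rw [pow_succ]
        omega
      · rw [min_eq_right hj] at ih
        rw [min_eq_right (Nat.le_succ_of_le hj)]
        refine ih.bind_left fun c' i ⟨h, htime⟩ => ?_
        have hdone : c'.regs rounds = [] := by
          rw [h.2.2.1, Nat.sub_eq_zero_of_le (Nat.lt_size_self M)]
          rfl
        rw [sampleRound, Prog.run, if_pos (by simp [hdone]), Prog.run]
        refine .pure ⟨h, ?_⟩
        simp only [Cfg.tick_time]
        omega
  have hsize : 2 ^ M.size ≤ 2 * M + 1 := by
    rcases Nat.eq_zero_or_eq_succ_pred M.size with h | h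
    · simp [h]
    · have := Nat.lt_size.1 (h ▸ Nat.lt_succ_self _ : M.size.pred < M.size)
      rw [h, pow_succ]
      omega
  have hM := hrepeat M
  rw [min_eq_right (Nat.size_le.2 Nat.lt_two_pow_self)] at hM
  rw [sampleCode, Prog.run, hrounds, unary, List.length_replicate]
  refine hM.mono fun c' i ⟨h, htime⟩ => ⟨h.1, h.2.2.2.1, h.2.2.2.2, by omega⟩

end Sampling

section Reduction

variable {σ τ : Type} {O : Oracle σ}

theorem regs_ofInputs_nil (l : List Word) : Regs.ofInputs (l ++ [[], []]) = Regs.ofInputs l := by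
  funext i
  rcases lt_or_ge i l.length with h | h
  · simp [Regs.ofInputs, List.getElem?_append_left h]
  · obtain ⟨j, rfl⟩ := Nat.exists_eq_add_of_le h
    rcases j with _ | _ | j <;> simp [Regs.ofInputs]

/-- The privacy experiment for given parameters, with a prover that has a state, in which the
adversary sees only the first `L` bits of the public keys. -/
def simExperiment (P : Oracle τ) (D : Simulator) (B : Prog) (n : ℕ) (pp : Word) (L : ℕ) (t : τ) :
    PMF Bool :=
  (activateFrom P D.keyGen [unary n, pp] t).bind fun k =>
    (B.run (D.statefulOracle P n pp) (Cfg.start [unary n, pp, k.1.take L] k.2)).bind fun c =>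
      (activateFrom P D.showPhase [unary n, pp, c.env.1, c.regs 0] c.env.2).map fun v =>
        decide (v.1 = [true])

/-- Choose the hybrid: a number below the first power of `2` that exceeds `(n + 2) ^ b`. -/
def setupCode (a b : ℕ) : Prog := .seq (initCode a b) sampleCode

theorem setupCode_coupled (a b : ℕ) {c : Cfg σ} {n : ℕ} (hn : (c.regs secParam).length = n) :
    Coupled (fun c' i => c'.regs secParam = unary n ∧ c'.regs params = c.regs params ∧
        c'.regs limit = unary ((n + 2) ^ a) ∧ c'.regs message = [] ∧
        Keeps c'.regs c'.env ([], i + 1, c.env) ∧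
        c'.time ≤ c.time + (15 + 3 * n + 4 * (n + 2) ^ a + 21 * (n + 2) ^ b))
      ((setupCode a b).run O c) (uniformBelow ((n + 2) ^ b).size) := by
  obtain ⟨c₁, hrun, hsecParam, hparams, hlimit, hrounds, hpower, hmessage,
    ⟨hstate, hcounter, henv⟩, htime⟩ := run_initCode (O := O) a b hn
  rw [setupCode, Prog.run, hrun, PMF.pure_bind]
  refine (sampleCode_coupled hcounter hpower hrounds).mono
    fun c₂ i ⟨hcounter', hregs, henv', htime'⟩ => ?_
  have hkeep {s : Slot} (hs : s ∉ [bit, counter, power, rounds]) := hregs s hs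
  refine ⟨(hkeep (by simp)).trans hsecParam, (hkeep (by simp)).trans hparams,
    (hkeep (by simp)).trans hlimit, (hkeep (by simp)).trans hmessage,
    ⟨(hkeep (by simp)).trans hstate, hcounter', henv'.trans henv⟩, by omega⟩

/-- Generate the keys and load the inputs of the adversary. -/
def keyCode (N : NIZK) (D : Simulator) (B : Prog) : Prog :=
  .seq (activationCode N D.keyGen) <| .seq truncateCode <|
    load adv (max 3 B.width) [secParam, params, answer]

theorem exists_keyCode_coupled (N : NIZK) (D : Simulator) (B : Prog) :
    ∃ G : Polynomial ℕ, ∀ {σ : Type} {O : Oracle σ} {c : Cfg σ} {t : ℕ × σ} {n L m : ℕ} {pp : Word},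
    c.regs secParam = unary n → c.regs params = pp → c.regs limit = unary L → c.regs message = [] →
    Keeps c.regs c.env ([], t) → n ≤ m → pp.length ≤ m → L ≤ m → D.TimeBound n pp m →
    Coupled (fun c' k => (∀ r < max 3 B.width, c'.regs (adv r) =
          [unary n, pp, k.1.take L].getD r []) ∧
        c'.regs secParam = unary n ∧ c'.regs params = pp ∧
        Keeps c'.regs c'.env k.2 ∧ c'.time ≤ c.time + G.eval m)
      ((keyCode N D B).run O c)
      (activateFrom (N.gameProver O pp) D.keyGen [unary n, pp] t) := by
  obtain ⟨G, hG⟩ := exists_activationCode_coupled N D.keyGen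
  refine ⟨G + 13 * Polynomial.X + Polynomial.C (B.width + 12),
    fun {σ O c t n L m pp} hn hparams hL hmessage hs hnm hpp hLm hT => ?_⟩
  subst hparams
  have hinputs : Regs.ofInputs [c.regs secParam, c.regs params, [], c.regs message] =
      Regs.ofInputs [unary n, c.regs params] := by
    rw [hn, hmessage]
    exact regs_ofInputs_nil [unary n, c.regs params]
  have hkey := hG (O := O) (c := c) (s := ([], t)) (m := m) (by simpa [hn, unary]) hpp
    (by simpa only [Prog.TimeBound, Cfg.start, hinputs] using hT.1) hs
  simp only [activateFrom, Cfg.start, hinputs] at hkey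
  rw [keyCode, Prog.run]
  refine hkey.bind_left fun c₁ k ⟨hframe₁, hanswer, ⟨hstate, hcounter, henv⟩, htime₁⟩ => ?_
  obtain ⟨c₂, hrun₂, hanswer₂, hregs₂, henv₂, htime₂⟩ := run_truncateCode (O := O) c₁
  obtain ⟨c₃, hrun₃, hblock, hregs₃, henv₃, htime₃⟩ := run_load (O := O) (e := adv)
    (l := [secParam, params, answer]) (fun r r' h => by simpa using h) (by simp) (by simp)
    (max 3 B.width) c₂
  have hlow {s : Slot} (hs : s ∉ [answer, buffer, trash]) (hse : ∀ r, s ≠ adv r) :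
      c₃.regs s = c₁.regs s := by
    simp only [List.mem_cons, List.not_mem_nil, or_false, not_or] at hs
    rw [hregs₃ s hs.2.2 hse, hregs₂ s (by simp [hs])]
  have hlimit₁ : c₁.regs limit = unary L := (hframe₁ limit (by decide)).trans hL
  have hsecParam₁ : c₁.regs secParam = unary n := (hframe₁ secParam (by decide)).trans hn
  have hparams₁ : c₁.regs params = c.regs params := hframe₁ params (by decide)
  have hloaded : ([secParam, params, answer].map fun s : Slot => c₂.regs s) =
      [unary n, c.regs params, k.1.take L] := by
    simp [hregs₂, hsecParam₁, hparams₁, hanswer₂, hanswer, hlimit₁, unary]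
  rw [Prog.run, hrun₂, PMF.pure_bind, hrun₃]
  rw [hloaded] at hblock htime₃
  refine .pure ⟨hblock, (hlow (by simp) (by simp)).trans hsecParam₁,
    (hlow (by simp) (by simp)).trans hparams₁, ⟨(hlow (by simp) (by simp)).trans hstate,
      (hlow (by simp) (by simp)).trans hcounter, henv₃.trans (henv₂.trans henv)⟩, ?_⟩
  simp only [hlimit₁, unary, List.length_replicate, List.length_cons, List.length_nil, zero_add,
    Nat.reduceAdd, totalLength, List.map_cons, List.length_take, List.map_nil, List.sum_cons,
    List.sum_nil, add_zero, eq_natCast, Nat.cast_add, Nat.cast_ofNat, Polynomial.eval_add,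
    Polynomial.eval_mul, Polynomial.eval_ofNat, Polynomial.eval_X, Polynomial.eval_natCast,
    Nat.cast_id] at htime₂ htime₃ ⊢
  omega

/-- Run the adversary. -/
def attackCode (N : NIZK) (D : Simulator) (B : Prog) : Prog :=
  B.inline (fun r => adv r) (queryCode N D)

theorem exists_attackCode_coupled (N : NIZK) (D : Simulator) (B : Prog) :
    ∃ G : Polynomial ℕ, ∀ {σ : Type} {O : Oracle σ} {c : Cfg σ} {s : Word × ℕ × σ} {n m : ℕ}
      {pp pk : Word},
    (∀ r < max 3 B.width, c.regs (adv r) = [unary n, pp, pk].getD r []) →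
    c.regs secParam = unary n → c.regs params = pp → Keeps c.regs c.env s → n ≤ m →
    pp.length ≤ m → D.TimeBound n pp m → B.TimeBound [unary n, pp, pk] m →
    Coupled (fun c' d => c'.regs (adv 0) = d.regs 0 ∧ c'.regs secParam = unary n ∧
        c'.regs params = pp ∧ Keeps c'.regs c'.env d.env ∧ c'.time ≤ c.time + G.eval m)
      ((attackCode N D B).run O c)
      (B.run (D.statefulOracle (N.gameProver O pp) n pp) (Cfg.start [unary n, pp, pk] s)) := by
  obtain ⟨G, hG⟩ := exists_queryCode_coupled N D
  refine ⟨(G + 8) * Polynomial.X, fun {σ O c s n m pp pk} hblock hn hparams hs hnm hpp hT hB => ?_⟩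
  have hattack := inline_coupled (O := O)
    (O' := D.statefulOracle (N.gameProver O pp) n pp) (p := B)
    (e := fun r => adv r) (h := queryCode N D) (F := G.eval m + 8) (T := m) (c := c) (t := s)
    (I := fun regs env s => regs secParam = unary n ∧ regs params = pp ∧ Keeps regs env s)
    (fun r r' h => by simpa using h) (le_max_right 3 B.width) (Nat.succ_pos _)
    (fun r w hI => by simpa [Keeps] using hI)
    (fun {c' s'} args res ⟨hn', hpp', hs'⟩ hargs => by
      have hquery := hG (O := O) rfl res hn' hnm (hpp' ▸ hpp) (hpp' ▸ hT) hs' (args := args)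
      rw [hpp'] at hquery
      refine hquery.mono fun c'' a ⟨hframe, hkeeps, htime⟩ =>
        ⟨fun r => hframe (adv r) (by simp [level]), ⟨?_, ?_, hkeeps⟩, htime.trans ?_⟩
      · simpa [hn'] using hframe secParam (by decide)
      · simpa [hpp'] using hframe params (by decide)
      · nlinarith)
    hB hblock ⟨hn, hparams, hs⟩
  refine hattack.mono fun c' d ⟨hregs, ⟨hn', hpp', hs'⟩, htime⟩ =>
    ⟨hregs 0 (by simp), hn', hpp', hs', ?_⟩
  simpa using htime

/-- Run the last phase of the experiment and output its verdict. -/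
def showCode (N : NIZK) (D : Simulator) : Prog :=
  .seq (.move message (adv 0)) <| .seq (activationCode N D.showPhase) (.move secParam answer)

theorem exists_showCode_coupled (N : NIZK) (D : Simulator) :
    ∃ G : Polynomial ℕ, ∀ {σ : Type} {O : Oracle σ} {c : Cfg σ} {s : Word × ℕ × σ} {n m : ℕ}
      {pp : Word},
    c.regs secParam = unary n → c.regs params = pp → Keeps c.regs c.env s → n ≤ m →
    pp.length ≤ m → D.TimeBound n pp m →
    Coupled (fun c' v => c'.regs secParam = v.1 ∧ c'.time ≤ c.time + G.eval m)
      ((showCode N D).run O c)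
      (activateFrom (N.gameProver O pp) D.showPhase [unary n, pp, s.1, c.regs (adv 0)] s.2) := by
  obtain ⟨G, hG⟩ := exists_activationCode_coupled N D.showPhase
  refine ⟨G + 2, fun {σ O c s n m pp} hn hparams hs hnm hpp hT => ?_⟩
  subst hparams
  set c₁ : Cfg σ := ((c.set (adv 0) []).set message (c.regs (adv 0))).tick 1 with hc₁
  have hsecParam : c₁.regs secParam = unary n := by simpa [hc₁]
  have hparams : c₁.regs params = c.regs params := by simp [hc₁]
  have hmessage : c₁.regs message = c.regs (adv 0) := by simp [hc₁]
  have hshow := hG (O := O) (c := c₁) (s := s) (m := m) (by simpa [hsecParam, unary])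
    (by rwa [hparams])
    (by rw [hsecParam, hparams]; exact (hT.2 _ _).2.2) (by simpa [Keeps, hc₁] using hs)
  rw [hsecParam, hparams, hmessage] at hshow
  rw [showCode, Prog.run, Prog.run, PMF.pure_bind, Prog.run]
  refine hshow.bind_left fun c₂ v ⟨_, hanswer, _, htime⟩ => .pure ⟨by simp [hanswer], ?_⟩
  simp only [hc₁, Cfg.tick_time, Cfg.set_time, Polynomial.eval_add, Polynomial.eval_ofNat,
    Order.add_one_le_iff] at htime ⊢
  omega

/-- The distinguisher for the randomizability game: it runs the privacy experiment with the prover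
`NIZK.gameProver` that starts in a random hybrid. -/
def reduction (N : NIZK) (D : Simulator) (B : Prog) (a b : ℕ) : Prog :=
  .seq (setupCode a b) <| .seq (keyCode N D B) <| .seq (attackCode N D B) (showCode N D)

theorem exists_reduction_coupled (N : NIZK) (D : Simulator) (B : Prog) (a b : ℕ) :
    ∃ G : Polynomial ℕ, ∀ {σ : Type} {O : Oracle σ} {c : Cfg σ} {n m : ℕ} {pp : Word},
    (c.regs secParam).length = n → c.regs params = pp → n ≤ m → pp.length ≤ m →
    (n + 2) ^ a ≤ m → (n + 2) ^ b ≤ m → D.TimeBound n pp m →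
    (∀ pk : Word, pk.length ≤ (n + 2) ^ a → B.TimeBound [unary n, pp, pk] m) →
    Coupled (fun c' v => decide (c'.regs secParam = [true]) = v ∧ c'.time ≤ c.time + G.eval m)
      ((reduction N D B a b).run O c)
      ((uniformBelow ((n + 2) ^ b).size).bind fun i =>
        simExperiment (N.gameProver O pp) D B n pp ((n + 2) ^ a) (i + 1, c.env)) := by
  obtain ⟨G₁, hG₁⟩ := exists_keyCode_coupled N D B
  obtain ⟨G₂, hG₂⟩ := exists_attackCode_coupled N D B
  obtain ⟨G₃, hG₃⟩ := exists_showCode_coupled N D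
  refine ⟨15 + 28 * Polynomial.X + G₁ + G₂ + G₃,
    fun {σ O c n m pp} hn hparams hnm hpp ha hb hD hB => ?_⟩
  rw [reduction, Prog.run]
  refine (setupCode_coupled a b hn).bind
    fun c₁ i ⟨hn₁, hparams₁, hlimit, hmessage, hs₁, htime₁⟩ => ?_
  rw [Prog.run, simExperiment]
  refine (hG₁ hn₁ (hparams₁.trans hparams) hlimit hmessage hs₁ hnm hpp ha hD).bind
    fun c₂ k ⟨hblock, hn₂, hparams₂, hs₂, htime₂⟩ => ?_
  rw [Prog.run]
  refine (hG₂ hblock hn₂ hparams₂ hs₂ hnm hpp hD (hB _ (List.length_take_le _ _))).bind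
    fun c₃ d ⟨hfaith, hn₃, hparams₃, hs₃, htime₃⟩ => ?_
  rw [← hfaith]
  refine (hG₃ hn₃ hparams₃ hs₃ hnm hpp hD).map_right fun c₄ v ⟨hverdict, htime₄⟩ =>
    ⟨by rw [hverdict], ?_⟩
  simp only [Polynomial.eval_add, Polynomial.eval_mul, Polynomial.eval_X, Polynomial.eval_ofNat]
  omega

end Reduction

section Comparison

variable {σ τ : Type} {E : ℕ → σ → τ → Prop} {P : Oracle σ} {P' : Oracle τ}

/-- The relations `E k` between the states of two oracles guarantee that they answer the next `k`
calls alike. -/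
structure AgreeFor (E : ℕ → σ → τ → Prop) (P : Oracle σ) (P' : Oracle τ) : Prop where
  anti : ∀ {k k' s t}, k ≤ k' → E k' s t → E k s t
  call : ∀ {k s t} (args : List Word), E (k + 1) s t →
    Coupled (fun a b => a.1 = b.1 ∧ E k a.2 b.2) (P args s) (P' args t)

theorem activateFrom_coupled (hE : AgreeFor E P P') {p : Prog} {inputs : List Word} {T : ℕ}
    (hT : p.TimeBound inputs T) (k : ℕ) {s : σ} {t : τ} (hst : E (k + T) s t) :
    Coupled (fun a b => a.1 = b.1 ∧ a.2.1 = b.2.1 ∧ E k a.2.2 b.2.2)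
      (activateFrom P p inputs s) (activateFrom P' p inputs t) := by
  have hrun := run_coupled (O := P) (O' := P') (T := T) (E := fun u s t => E (k + (T - u)) s t)
    (fun _ => hE.anti (by omega)) (fun args _ hst => hE.call args (hE.anti (by omega) hst)) p
    (c := Cfg.start inputs s) (d := Cfg.start inputs t) rfl rfl hst
  refine (hrun.mono_support fun c _ d hd hcd => hcd (hT _ _ _ d hd)).map
    fun c d ⟨hregs, _, henv⟩ => ⟨?_, ?_, hE.anti (Nat.le_add_right _ _) henv⟩ <;> rw [hregs]

theorem Simulator.statefulOracle_coupled (hE : AgreeFor E P P') {D : Simulator} {n T : ℕ}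
    {pp : Word} (hT : D.TimeBound n pp T) (k : ℕ) (args : List Word) {s : Word × σ} {t : Word × τ}
    (hst : s.1 = t.1 ∧ E (k + T) s.2 t.2) :
    Coupled (fun a b => a.1 = b.1 ∧ a.2.1 = b.2.1 ∧ E k a.2.2 b.2.2)
      (D.statefulOracle P n pp args s) (D.statefulOracle P' n pp args t) := by
  rw [statefulOracle, statefulOracle, hst.1]
  refine activateFrom_coupled hE ?_ k hst.2
  split_ifs
  · exact (hT.2 _ _).2.1
  · exact (hT.2 _ _).1

-- The simulator makes at most `T` calls in each of its at most `T' + 2` activations.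
theorem simExperiment_congr (hE : AgreeFor E P P') {D : Simulator} {B : Prog} {n L T T' : ℕ}
    {pp : Word} (hD : D.TimeBound n pp T)
    (hB : ∀ pk : Word, pk.length ≤ L → B.TimeBound [unary n, pp, pk] T') {s : σ} {t : τ}
    (hst : E (T * (T' + 2)) s t) :
    simExperiment P D B n pp L s = simExperiment P' D B n pp L t := by
  have hkeys := activateFrom_coupled hE hD.1 (T * (T' + 1)) (hst : E (T * (T' + 1) + T) s t)
  refine hkeys.bind_eq fun k l ⟨hpk, hstate, hkl⟩ => ?_
  rw [hpk]
  have hcalls {u v : ℕ} (hu : u + (1 + v) ≤ T') :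
      T * (T' - (u + (1 + v)) + 1) + T ≤ T * (T' - u + 1) := by
    rw [← Nat.mul_succ]
    exact Nat.mul_le_mul_left _ (by omega)
  have hattack := run_coupled (O := D.statefulOracle P n pp) (O' := D.statefulOracle P' n pp)
    (E := fun u s t => s.1 = t.1 ∧ E (T * (T' - u + 1)) s.2 t.2) (T := T')
    (fun hu hst => ⟨hst.1, hE.anti (by gcongr) hst.2⟩)
    (fun args hu hst => Simulator.statefulOracle_coupled hE hD _ args ⟨hst.1,
      hE.anti (hcalls hu) hst.2⟩) B
    (c := Cfg.start [unary n, pp, l.1.take L] k.2) (d := Cfg.start [unary n, pp, l.1.take L] l.2)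
    rfl rfl ⟨hstate, hkl⟩
  refine (hattack.mono_support fun c _ d hd hcd =>
    hcd (hB _ (List.length_take_le _ _) _ _ _ d hd)).bind_eq
      fun c d ⟨hregs, _, hstate, henv⟩ => ?_
  rw [hregs, hstate]
  have hshow := activateFrom_coupled hE (hD.2 d.env.1 (d.regs 0)).2.2 0
    (hE.anti (by rw [zero_add]; exact Nat.le_mul_of_pos_right _ (Nat.succ_pos _)) henv)
  exact hshow.map_eq fun a b hab => by rw [hab.1]

theorem run_oracle_coupled (P : Oracle Unit) (D : Simulator) {B : Prog} {inputs : List Word}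
    {n T : ℕ} {pp : Word} (hT : B.TimeBound inputs T) (st : Word) :
    Coupled (fun c d => c.regs = d.regs ∧ c.env = d.env.1)
      (B.run (D.oracle P n pp) (Cfg.start inputs st))
      (B.run (D.statefulOracle P n pp) (Cfg.start inputs (st, ()))) := by
  have hrun := run_coupled (O := D.oracle P n pp) (O' := D.statefulOracle P n pp) (T := T)
    (E := fun _ st s => st = s.1) (fun _ h => h)
    (fun args _ h => h ▸ (Coupled.refl _).map fun c d hcd => by subst hcd; exact ⟨rfl, rfl⟩) B
    (c := Cfg.start inputs st) (d := Cfg.start inputs (st, ())) rfl rfl rfl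
  exact hrun.mono_support fun c _ d hd hcd =>
    ⟨(hcd (hT _ _ _ d hd)).1, (hcd (hT _ _ _ d hd)).2.2⟩

theorem privacyExperiment_eq {N : NIZK} {prover : Word → Oracle Unit} {D : Simulator} {B : Prog}
    {n L : ℕ} (hB : B.PPT) (hL : ∀ pp ∈ (N.setup.out [unary n]).support,
      ∀ k ∈ (activate (prover pp) D.keyGen [unary n, pp]).support, k.1.length ≤ L) :
    privacyExperiment N prover D B n =
      (N.setup.out [unary n]).bind fun pp => simExperiment (prover pp) D B n pp L () := by
  obtain ⟨g, hg⟩ := hB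
  refine bind_congr_support fun pp hpp => ?_
  have hkeys : Coupled (fun k l => k.1.length ≤ L ∧ l = (k.1, k.2, ()))
      (activate (prover pp) D.keyGen [unary n, pp])
      (activateFrom (prover pp) D.keyGen [unary n, pp] ()) :=
    ((Coupled.refl _).map (R := fun c d => c = d) fun c d hcd => by
      subst hcd; rfl).mono_support fun k hk l _ hkl => ⟨hL pp hpp k hk, hkl⟩
  refine hkeys.bind_eq fun k l ⟨hk, hkl⟩ => ?_
  subst hkl
  rw [List.take_of_length_le hk]
  refine (run_oracle_coupled (prover pp) D (hg _) k.2).bind_eq fun c d ⟨hregs, henv⟩ => ?_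
  rw [activate, activateFrom, PMF.map_comp, PMF.map_comp, hregs, henv]
  rfl

end Comparison

section Counting

namespace NIZK

variable {N : NIZK} {pp : Word}

/-- Randomize the proof `π` of `x` if the counter is positive, and count down. -/
def randomizeCounted (N : NIZK) (pp x π : Word) : ℕ → PMF (Word × ℕ)
  | 0 => PMF.pure (π, 0)
  | j + 1 => (N.rand.out [pp, x, π]).map fun π' => (π', j)

/-- The prover of the hybrid experiments, which randomizes the first proofs, as many as its state
says. -/
def countProver (N : NIZK) (pp : Word) : Oracle ℕ := fun args j =>
  let x := args.getD 0 []
  let w := args.getD 1 []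
  if N.rel pp x w = true then (N.prove.out [pp, x, w]).bind fun π => N.randomizeCounted pp x π j
  else PMF.pure ([], j)

theorem agreeFor_freshProofs (N : NIZK) (pp : Word) :
    AgreeFor (fun _ _ j => j = 0) (N.freshProofs pp) (N.countProver pp) where
  anti _ h := h
  call {_ _ _} args ht := by
    subst ht
    simp only [freshProofs, countProver]
    split_ifs
    · exact (Coupled.refl _).bind fun π _ h => h ▸ .pure ⟨rfl, rfl⟩
    · exact .pure ⟨rfl, rfl⟩

theorem agreeFor_randomizedProofs (N : NIZK) (pp : Word) :
    AgreeFor (fun k _ j => k ≤ j) (N.randomizedProofs pp) (N.countProver pp) where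
  anti := le_trans
  call {k s t} args ht := by
    obtain ⟨j, rfl⟩ := Nat.exists_eq_add_of_le' (Nat.le_of_add_left_le ht)
    simp only [randomizedProofs, countProver]
    split_ifs
    · refine (Coupled.refl _).bind fun π _ h => h ▸ (Coupled.refl _).map fun π' _ h => h ▸ ⟨rfl, ?_⟩
      exact Nat.le_of_succ_le_succ ht
    · exact .pure ⟨rfl, Nat.le_of_succ_le ht⟩

/-- The states of `NIZK.gameProver` with the challenge for the bit `β`, and the states of
`NIZK.countProver` that correspond to them: the challenge counts as a randomization if `β`. -/
def SameCount (β : Bool) : ℕ × Bool → ℕ → Prop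
  | (0, _), j => j = 0
  | (i + 1, used), j => used = false ∧ j = i + β.toNat

theorem treatProof_challenge (hN : N.Complete) {n : ℕ}
    (hpp : pp ∈ (N.setup.out [unary n]).support) (β : Bool) {x w π : Word}
    (hxw : N.rel pp x w = true) (hπ : π ∈ (N.prove.out [pp, x, w]).support) :
    N.treatProof (N.challenge β pp) pp x w π (1, false) =
      (if β then N.rand.out [pp, x, π] else N.prove.out [pp, x, w]).map
        fun π' => (π', (0, true)) := by
  have hverify := hN n pp hpp x w hxw π hπ
  simp only [treatProof, challenge, List.getD_cons_zero, List.getD_cons_succ, hxw, hverify,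
    and_self, if_true, PMF.pure_bind, PMF.map_comp]
  rfl

theorem treatProof_coupled (hN : N.Complete) {n : ℕ} (hpp : pp ∈ (N.setup.out [unary n]).support)
    {β : Bool} {x w : Word} (hxw : N.rel pp x w = true) {s : ℕ × Bool} {j : ℕ}
    (hs : SameCount β s j) :
    Coupled (fun a b => a.1 = b.1 ∧ SameCount β a.2 b.2)
      ((N.prove.out [pp, x, w]).bind fun π => N.treatProof (N.challenge β pp) pp x w π s)
      ((N.prove.out [pp, x, w]).bind fun π => N.randomizeCounted pp x π j) := by
  match s, hs with
  | (0, _), rfl => exact (Coupled.refl _).bind fun π _ h => h ▸ .pure ⟨rfl, rfl⟩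
  | (1, _), ⟨rfl, rfl⟩ =>
    rw [bind_congr_support fun π hπ => treatProof_challenge hN hpp β hxw hπ]
    cases β with
    | true =>
      exact (Coupled.refl _).bind fun π _ h => h ▸
        (Coupled.refl _).map fun π' _ h => h ▸ ⟨rfl, rfl⟩
    | false =>
      simp only [Bool.false_eq_true, if_false, PMF.bind_const]
      exact (Coupled.refl _).map fun π _ h => h ▸ ⟨rfl, rfl⟩
  | (i + 2, _), ⟨rfl, rfl⟩ =>
    rw [Nat.add_right_comm]
    exact (Coupled.refl _).bind fun π _ h => h ▸
      (Coupled.refl _).map fun π' _ h => h ▸ ⟨rfl, rfl, rfl⟩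

theorem agreeFor_gameProver (hN : N.Complete) {n : ℕ}
    (hpp : pp ∈ (N.setup.out [unary n]).support) (β : Bool) :
    AgreeFor (fun _ => SameCount β) (N.gameProver (N.challenge β pp) pp) (N.countProver pp) where
  anti _ h := h
  call args hst := by
    simp only [gameProver, countProver]
    split_ifs with hxw
    · exact treatProof_coupled hN hpp hxw hst
    · exact .pure ⟨rfl, hst⟩

end NIZK

end Counting

section Averages

theorem prOne_bind_uniformBool (f : Bool → PMF Bool) :
    prOne ((PMF.uniformOfFintype Bool).bind f) = (prOne (f false) + prOne (f true)) / 2 := by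
  have hne (b : Bool) : (2 : ENNReal)⁻¹ * f b true ≠ ⊤ :=
    ENNReal.mul_ne_top (by simp) (PMF.apply_ne_top _ _)
  simp only [prOne, PMF.bind_apply, tsum_fintype, Fintype.sum_bool, PMF.uniformOfFintype_apply,
    Fintype.card_bool, Nat.cast_ofNat, ENNReal.toReal_add (hne true) (hne false),
    ENNReal.toReal_mul, ENNReal.toReal_inv, ENNReal.toReal_ofNat]
  ring

theorem prOne_bind_uniformBelow (k : ℕ) (f : ℕ → PMF Bool) :
    prOne ((uniformBelow k).bind f) = (∑ i ∈ Finset.range (2 ^ k), prOne (f i)) / 2 ^ k := by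
  induction k generalizing f with
  | zero => simp [uniformBelow]
  | succ k ih =>
    have hbind : (uniformBelow (k + 1)).bind f = (uniformBelow k).bind fun i =>
        (PMF.uniformOfFintype Bool).bind fun b => f (i + b.toNat * 2 ^ k) := by
      simp only [uniformBelow, PMF.bind_bind, PMF.bind_map]
      rfl
    have hrange : ∑ i ∈ Finset.range (2 ^ (k + 1)), prOne (f i) =
        ∑ i ∈ Finset.range (2 ^ k), (prOne (f i) + prOne (f (i + 2 ^ k))) := by
      rw [pow_succ, mul_two, Finset.sum_range_add, ← Finset.sum_add_distrib]
      simp only [Nat.add_comm]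
    rw [hbind, ih, hrange, pow_succ, div_mul_eq_div_div_swap]
    simp only [prOne_bind_uniformBool, Bool.toNat_false, Bool.toNat_true, zero_mul, one_mul,
      Nat.add_zero, ← Finset.sum_div]

theorem prOne_sub_eq_telescope (k : ℕ) (f : ℕ → PMF Bool) :
    prOne (f (2 ^ k)) - prOne (f 0) =
      2 ^ k * (prOne ((uniformBelow k).bind fun i => f (i + 1)) -
        prOne ((uniformBelow k).bind f)) := by
  rw [prOne_bind_uniformBelow, prOne_bind_uniformBelow, ← sub_div, ← Finset.sum_sub_distrib,
    Finset.sum_range_sub (fun i => prOne (f i)), mul_div_cancel₀ _ (by positivity)]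

end Averages

section Bounds

variable {N : NIZK} {D : Simulator} {B : Prog}

theorem exists_eval_le_pow (f : Polynomial ℕ) : ∃ k, ∀ m, f.eval m ≤ (m + 2) ^ k := by
  induction f using Polynomial.induction_on' with
  | add p q hp hq =>
    obtain ⟨a, ha⟩ := hp
    obtain ⟨b, hb⟩ := hq
    refine ⟨max a b + 1, fun m => ?_⟩
    calc (p + q).eval m ≤ (m + 2) ^ max a b + (m + 2) ^ max a b := by
          rw [Polynomial.eval_add]
          exact Nat.add_le_add
            ((ha m).trans (Nat.pow_le_pow_right (Nat.succ_pos _) (le_max_left _ _)))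
            ((hb m).trans (Nat.pow_le_pow_right (Nat.succ_pos _) (le_max_right _ _)))
      _ = (m + 2) ^ max a b * 2 := (mul_two _).symm
      _ ≤ (m + 2) ^ (max a b + 1) := Nat.mul_le_mul_left _ (Nat.le_add_left _ _)
  | monomial i a =>
    refine ⟨a + i, fun m => ?_⟩
    rw [Polynomial.eval_monomial, pow_add]
    refine Nat.mul_le_mul ?_ (Nat.pow_le_pow_left (Nat.le_add_right _ _) _)
    exact (Nat.lt_two_pow_self (n := a)).le.trans (Nat.pow_le_pow_left (Nat.le_add_left _ _) _)

theorem Simulator.TimeBound.mono {n T T' : ℕ} {pp : Word} (h : D.TimeBound n pp T) (hT : T ≤ T') :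
    D.TimeBound n pp T' :=
  ⟨h.1.mono hT, fun st msg =>
    ⟨(h.2 st msg).1.mono hT, (h.2 st msg).2.1.mono hT, (h.2 st msg).2.2.mono hT⟩⟩

theorem exists_timeBound (hD : D.PPT) (hB : B.PPT) :
    ∃ f : Polynomial ℕ, ∀ {n m L : ℕ} {pp : Word}, n + pp.length + L ≤ m →
      D.TimeBound n pp (f.eval m) ∧
      ∀ pk : Word, pk.length ≤ L → B.TimeBound [unary n, pp, pk] (f.eval m) := by
  obtain ⟨f, hf⟩ := hD
  obtain ⟨g, hg⟩ := hB
  refine ⟨f + g, fun {n m L pp} hm => ⟨Simulator.TimeBound.mono (hf n pp) ?_,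
    fun pk hpk => (hg _).mono ?_⟩⟩ <;> rw [Polynomial.eval_add]
  · exact Nat.le_add_right_of_le (polynomial_eval_monotone f (by omega))
  · refine Nat.le_add_left_of_le (polynomial_eval_monotone g ?_)
    simp only [totalLength, unary, List.map_cons, List.map_nil, List.sum_cons, List.sum_nil,
      List.length_replicate]
    omega

theorem reduction_ppt (N : NIZK) (hD : D.PPT) (hB : B.PPT) (a b : ℕ) :
    (reduction N D B a b).PPT := by
  obtain ⟨f, hf⟩ := exists_timeBound hD hB
  obtain ⟨G, hG⟩ := exists_reduction_coupled N D B a b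
  let Q : Polynomial ℕ := 2 * Polynomial.X + (Polynomial.X + 2) ^ a
  let M : Polynomial ℕ := Q + f.comp Q + (Polynomial.X + 2) ^ b
  refine ⟨G.comp M, fun inputs σ O s c hc => ?_⟩
  set n := (inputs.getD 0 []).length
  set pp := inputs.getD 1 []
  set l := totalLength inputs
  have hQ : Q.eval l = 2 * l + (l + 2) ^ a := by simp [Q]
  have hM : M.eval l = Q.eval l + f.eval (Q.eval l) + (l + 2) ^ b := by
    simp [M, Polynomial.eval_comp]
  have hnl : n ≤ l := length_getD_le_totalLength inputs 0
  have hppl : pp.length ≤ l := length_getD_le_totalLength inputs 1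
  have hpow (e : ℕ) : (n + 2) ^ e ≤ (l + 2) ^ e := by gcongr
  have ha := hpow a
  have hb := hpow b
  obtain ⟨hDT, hBT⟩ := hf (n := n) (m := Q.eval l) (L := (n + 2) ^ a) (pp := pp) (by omega)
  obtain ⟨_, -, -, htime⟩ := (hG (c := Cfg.start inputs s) (n := n) (m := M.eval l) (pp := pp)
    rfl rfl (by omega) (by omega) (by omega) (by omega) (hDT.mono (by omega))
    fun pk hpk => (hBT pk hpk).mono (by omega)).exists_of_mem_support hc
  rw [Polynomial.eval_comp]
  exact htime.trans_eq (Nat.zero_add _)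

theorem NIZK.exists_answer_bound (N : NIZK) : ∃ A : Polynomial ℕ, ∀ pp args,
    (∀ a ∈ (N.freshProofs pp args ()).support,
      a.1.length ≤ A.eval (pp.length + totalLength args)) ∧
    ∀ a ∈ (N.randomizedProofs pp args ()).support,
      a.1.length ≤ A.eval (pp.length + totalLength args) := by
  obtain ⟨F, hF⟩ := N.exists_timeBound
  let V : Polynomial ℕ := 2 * Polynomial.X + F.comp (2 * Polynomial.X)
  let W : Polynomial ℕ := Polynomial.X + V
  refine ⟨W + F.comp W, fun pp args => ?_⟩
  set u := pp.length + totalLength args with hu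
  have hprove (π : Word) (hπ : π ∈ (N.prove.out [pp, args.getD 0 [], args.getD 1 []]).support) :
      π.length ≤ V.eval u := by
    have hinputs := totalLength_cons_getD_le pp args
    refine (length_le_of_mem_out (hF _ _ hinputs).2.1 hπ).trans ?_
    simpa only [V, Polynomial.eval_add, Polynomial.eval_mul, Polynomial.eval_comp,
      Polynomial.eval_ofNat, Polynomial.eval_X] using Nat.add_le_add_right hinputs _
  have hrand (π π' : Word) (hπ : π.length ≤ V.eval u)
      (hπ' : π' ∈ (N.rand.out [pp, args.getD 0 [], π]).support) :
      π'.length ≤ (W + F.comp W).eval u := by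
    have hinputs : totalLength [pp, args.getD 0 [], π] ≤ W.eval u := by
      have := length_getD_le_totalLength args 0
      simp only [totalLength, W, List.map_cons, List.map_nil, List.sum_cons, List.sum_nil,
        Polynomial.eval_add, Polynomial.eval_X, hu] at *
      omega
    refine (length_le_of_mem_out (hF _ _ hinputs).2.2 hπ').trans ?_
    simpa [Polynomial.eval_comp]
  constructor <;> intro a ha
  · simp only [freshProofs] at ha
    split_ifs at ha
    · obtain ⟨π, hπ, rfl⟩ := (PMF.mem_support_map_iff _ _ _).1 ha
      exact (hprove π hπ).trans (by simp only [W, Polynomial.eval_add]; omega)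
    · simp [(PMF.mem_support_pure_iff _ _).1 ha]
  · simp only [randomizedProofs] at ha
    split_ifs at ha
    · obtain ⟨π, hπ, ha⟩ := (PMF.mem_support_bind_iff _ _ _).1 ha
      obtain ⟨π', hπ', rfl⟩ := (PMF.mem_support_map_iff _ _ _).1 ha
      exact hrand π π' (hprove π hπ) hπ'
    · simp [(PMF.mem_support_pure_iff _ _).1 ha]

theorem length_le_of_mem_activate {P : Oracle Unit} {p : Prog} {inputs : List Word} {A T : ℕ}
    (hP : ∀ args, totalLength args ≤ T → ∀ a ∈ (P args ()).support, a.1.length ≤ A)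
    (hp : p.TimeBound inputs T) {k : Word × Word} (hk : k ∈ (activate P p inputs).support) :
    k.1.length ≤ totalLength inputs + A + T := by
  obtain ⟨c, hc, rfl⟩ := (PMF.mem_support_map_iff _ _ _).1 hk
  have htime := hp _ _ _ c hc
  refine (length_le_of_mem_run (A := totalLength inputs + A) (fun args _ hargs a ha =>
    (hP args hargs a ha).trans (Nat.le_add_left _ _)) (fun r => ?_) hc htime 0).trans
    (Nat.add_le_add_left htime _)
  exact (length_getD_le_totalLength inputs r).trans (Nat.le_add_right _ _)

theorem NIZK.exists_params_bound (N : NIZK) : ∃ S : Polynomial ℕ, ∀ n,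
    ∀ pp ∈ (N.setup.out [unary n]).support, pp.length ≤ S.eval n := by
  obtain ⟨s, hs⟩ := N.setup_ppt
  refine ⟨Polynomial.X + s, fun n pp hpp => (length_le_of_mem_out (hs _) hpp).trans_eq ?_⟩
  simp [totalLength, unary]

theorem exists_publicKey_bound (N : NIZK) (hD : D.PPT) : ∃ a, ∀ n,
    ∀ pp ∈ (N.setup.out [unary n]).support,
      (∀ k ∈ (activate (N.freshProofs pp) D.keyGen [unary n, pp]).support,
        k.1.length ≤ (n + 2) ^ a) ∧
      ∀ k ∈ (activate (N.randomizedProofs pp) D.keyGen [unary n, pp]).support,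
        k.1.length ≤ (n + 2) ^ a := by
  obtain ⟨S, hS⟩ := N.exists_params_bound
  obtain ⟨f, hf⟩ := hD
  obtain ⟨A, hA⟩ := N.exists_answer_bound
  let U : Polynomial ℕ := Polynomial.X + S
  obtain ⟨a, ha⟩ := exists_eval_le_pow (U + A.comp (S + f.comp U) + f.comp U)
  refine ⟨a, fun n pp hpp => ?_⟩
  have hlen := hS n pp hpp
  have hinputs : totalLength [unary n, pp] ≤ U.eval n := by simpa [totalLength, unary, U] using hlen
  have htime : D.keyGen.TimeBound [unary n, pp] ((f.comp U).eval n) := by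
    refine (hf n pp).1.mono ?_
    rw [Polynomial.eval_comp]
    exact polynomial_eval_monotone f (by simpa [U] using hlen)
  have hkey {P : Oracle Unit} (hP : ∀ args, ∀ a ∈ (P args ()).support,
      a.1.length ≤ A.eval (pp.length + totalLength args)) {k : Word × Word}
      (hk : k ∈ (activate P D.keyGen [unary n, pp]).support) : k.1.length ≤ (n + 2) ^ a := by
    refine (length_le_of_mem_activate (A := (A.comp (S + f.comp U)).eval n)
      (fun args hargs a ha => (hP args a ha).trans ?_) htime hk).trans (le_trans ?_ (ha n))
    · rw [Polynomial.eval_comp, Polynomial.eval_add]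
      exact polynomial_eval_monotone A (Nat.add_le_add hlen hargs)
    · simp only [Polynomial.eval_add]
      omega
  exact ⟨fun k => hkey fun args => (hA pp args).1, fun k => hkey fun args => (hA pp args).2⟩

end Bounds

section Hybrids

variable {N : NIZK} {D : Simulator} {B : Prog}

/-- The privacy experiment in which the first `j` proofs are randomized and the public keys are cut
off at length `(n + 2) ^ a`. -/
def hybrid (N : NIZK) (D : Simulator) (B : Prog) (a n j : ℕ) : PMF Bool :=
  (N.setup.out [unary n]).bind fun pp =>
    simExperiment (N.countProver pp) D B n pp ((n + 2) ^ a) j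

theorem exists_hybrid_bounds (N : NIZK) (hD : D.PPT) (hB : B.PPT) :
    ∃ a b, ∀ n, UPri N B D n = hybrid N D B a n 0 ∧
      ∀ j, (n + 2) ^ b ≤ j → UPriModified N B D n = hybrid N D B a n j := by
  obtain ⟨S, hS⟩ := N.exists_params_bound
  obtain ⟨a, ha⟩ := exists_publicKey_bound N hD
  obtain ⟨f, hf⟩ := exists_timeBound hD hB
  let T : Polynomial ℕ := f.comp (Polynomial.X + S + (Polynomial.X + 2) ^ a)
  obtain ⟨b, hb⟩ := exists_eval_le_pow (T * (T + 2))
  have htime {n : ℕ} {pp : Word} (hpp : pp ∈ (N.setup.out [unary n]).support) :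
      D.TimeBound n pp (T.eval n) ∧
        ∀ pk : Word, pk.length ≤ (n + 2) ^ a → B.TimeBound [unary n, pp, pk] (T.eval n) := by
    rw [Polynomial.eval_comp]
    exact hf (by simpa using hS n pp hpp)
  refine ⟨a, b, fun n => ⟨?_, fun j hj => ?_⟩⟩
  · rw [UPri, privacyExperiment_eq hB fun pp hpp => (ha n pp hpp).1]
    exact bind_congr_support fun pp hpp =>
      simExperiment_congr (N.agreeFor_freshProofs pp) (htime hpp).1 (htime hpp).2 rfl
  · rw [UPriModified, privacyExperiment_eq hB fun pp hpp => (ha n pp hpp).2]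
    refine bind_congr_support fun pp hpp =>
      simExperiment_congr (N.agreeFor_randomizedProofs pp) (htime hpp).1 (htime hpp).2 ?_
    simpa using (hb n).trans hj

theorem randGame_reduction (hN : N.Complete) (hD : D.PPT) (hB : B.PPT) (a b n : ℕ) (β : Bool) :
    N.randGame (reduction N D B a b) β n =
      (uniformBelow ((n + 2) ^ b).size).bind fun i => hybrid N D B a n (i + β.toNat) := by
  obtain ⟨f, hf⟩ := exists_timeBound hD hB
  obtain ⟨G, hG⟩ := exists_reduction_coupled N D B a b
  unfold NIZK.randGame hybrid
  rw [PMF.bind_comm]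
  refine bind_congr_support fun pp hpp => ?_
  obtain ⟨hDT, hBT⟩ := hf (n := n) (pp := pp) (L := (n + 2) ^ a) le_rfl
  set t := f.eval (n + pp.length + (n + 2) ^ a)
  have hrun := hG (O := N.challenge β pp) (c := Cfg.start [unary n, pp] false)
    (n := n) (m := n + pp.length + (n + 2) ^ a + (n + 2) ^ b + t) (pp := pp)
    List.length_replicate rfl
    (by omega) (by omega) (by omega) (by omega) (hDT.mono (by omega))
    fun pk hpk => (hBT pk hpk).mono (by omega)
  refine (hrun.map_eq (g := id) fun _ _ h => h.1).trans ((PMF.map_id _).trans ?_)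
  refine congrArg _ (funext fun i => ?_)
  exact simExperiment_congr (NIZK.agreeFor_gameProver hN hpp β) hDT hBT ⟨rfl, rfl⟩

theorem two_pow_size_le {m : ℕ} (hm : m ≠ 0) : 2 ^ m.size ≤ 2 * m := by
  obtain ⟨k, hk⟩ := Nat.exists_eq_succ_of_ne_zero (Nat.size_pos.2 (Nat.pos_of_ne_zero hm)).ne'
  rw [hk, pow_succ']
  exact Nat.mul_le_mul_left 2 (Nat.lt_size.1 (hk ▸ Nat.lt_succ_self k))

theorem abs_prOne_sub_le (hN : N.Complete) (hD : D.PPT) (hB : B.PPT) {a b n : ℕ}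
    (hfresh : UPri N B D n = hybrid N D B a n 0)
    (hrand : ∀ j, (n + 2) ^ b ≤ j → UPriModified N B D n = hybrid N D B a n j) :
    |prOne (UPri N B D n) - prOne (UPriModified N B D n)| ≤
      2 * ((n : ℝ) + 2) ^ b * |prOne (N.randGame (reduction N D B a b) true n) -
        prOne (N.randGame (reduction N D B a b) false n)| := by
  have hsize : (2 : ℝ) ^ ((n + 2) ^ b).size ≤ 2 * ((n : ℝ) + 2) ^ b := by
    exact_mod_cast two_pow_size_le (pow_ne_zero b (Nat.succ_ne_zero _))
  rw [hfresh, hrand _ (Nat.lt_size_self _).le, abs_sub_comm, prOne_sub_eq_telescope,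
    randGame_reduction hN hD hB, randGame_reduction hN hD hB, abs_mul,
    abs_of_nonneg (by positivity)]
  exact mul_le_mul_of_nonneg_right hsize (abs_nonneg _)

theorem negligible_pow_mul {ν : ℕ → ℝ} (hν : Negligible ν) (b : ℕ) :
    Negligible fun n => 2 * ((n : ℝ) + 2) ^ b * ν n := by
  have := hν.polynomial_mul (2 * (Polynomial.X + 2) ^ b)
  simpa only [Negligible, Polynomial.eval_mul, Polynomial.eval_pow, Polynomial.eval_add,
    Polynomial.eval_X, Polynomial.eval_ofNat] using this

theorem negligible_half_pow : Negligible fun n => (1 / 2 : ℝ) ^ n := fun k =>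
  tendsto_pow_const_mul_const_pow_of_abs_lt_one k (by rw [abs_of_pos] <;> norm_num)

end Hybrids

end ZkFaith

end

theorem theorem2 (N : ZkFaith.NIZK) (hcomplete : N.Complete) (hrand : N.Randomizable)
    (B : ZkFaith.Prog) (hB : B.PPT) (D : ZkFaith.Simulator) (hD : D.PPT) :
    ∃ negl : ℕ → ℝ, ZkFaith.Negligible negl ∧ ∀ n : ℕ,
      |ZkFaith.prOne (ZkFaith.UPri N B D n) - ZkFaith.prOne (ZkFaith.UPriModified N B D n)|
        < negl n := by
  obtain ⟨a, b, hab⟩ := ZkFaith.exists_hybrid_bounds N hD hB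
  have hadvantage := hrand _ (ZkFaith.reduction_ppt N hD hB a b)
  exact ⟨_, (ZkFaith.negligible_pow_mul hadvantage b).add ZkFaith.negligible_half_pow, fun n =>
    lt_add_of_le_of_pos (ZkFaith.abs_prOne_sub_le hcomplete hD hB (hab n).1 (hab n).2)
      (by positivity)⟩
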